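/- Let $n\ge 1$, let $\Omega\subset\mathbb{R}^n$ be a bounded domain (non-empty, open, connected), let $p\ge 2$ and let $\alpha\in\mathbb{R}$ satisfy $2n<\alpha p<n+p$. Put $s=\alpha-n/p\in(0,1)$. Let $W^{s,p}_0(\Omega)$ be the closure of $C_0^\infty(\Omega)$ (smooth functions with compact support in $\Omega$) with respect to the norm $$\|u\|_{W^{s,p}(\Omega)}=\Bigl(\int_\Omega\!\int_\Omega\frac{|u(y)-u(x)|^p}{|y-x|^{sp+n}}\,dx\,dy+\int_\Omega|u|^p\,dx\Bigr)^{1/p},$$ its elements being extended by zero to $\mathbb{R}^n$. For $u\in W^{s,p}_0(\Omega)$, $u\not\equiv0$, let $$R(u)=\frac{\displaystyle\int_{\mathbb{R}^n}\!\int_{\mathbb{R}^n}\frac{|u(y)-u(x)|^p}{|y-x|^{\alpha p}}\,dx\,dy}{\displaystyle\int_{\mathbb{R}^n}|u|^p\,dx},\qquad \lambda_1=\inf\{R(\phi):\ \phi\in C_0^\infty(\Omega),\ \phi\not\equiv0\}.$$ A function $u\in W^{s,p}_0(\Omega)$, $u\not\equiv0$, is an eigenfunction with eigenvalue $\lambda\in\mathbb{R}$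 if $$\int_{\mathbb{R}^n}\!\int_{\mathbb{R}^n}\frac{|u(y)-u(x)|^{p-2}(u(y)-u(x))(\phi(y)-\phi(x))}{|y-x|^{\alpha p}}\,dx\,dy=\lambda\int_{\mathbb{R}^n}|u|^{p-2}u\,\phi\,dx\qquad\text{for all }\phi\in C_0^\infty(\Omega).$$ **Theorem.** Every non-negative eigenfunction $u$ is a minimizer of the Rayleigh quotient: $R(u)=\lambda_1$, and $R(u)\le R(v)$ for all $v\in W^{s,p}_0(\Omega)$, $v\not\equiv0$. Moreover $\lambda_1<\infty$ and the eigenvalue of $u$ is $\lambda=\lambda_1$. In particular, positive eigenfunctions belong only to the first eigenvalue $\lambda_1$. -/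

import Mathlib

open MeasureTheory
open scoped ENNReal

namespace FractionalEigenvalue

/-- `φ ∈ C₀^∞(D)`: smooth, with compact support contained in `D`. -/
def IsTestFunction {n : ℕ} (D : Set (EuclideanSpace ℝ (Fin n)))
    (φ : EuclideanSpace ℝ (Fin n) → ℝ) : Prop :=
  ContDiff ℝ ((⊤ : ℕ∞) : WithTop ℕ∞) φ ∧ HasCompactSupport φ ∧ tsupport φ ⊆ D

/-- The Sobolev-Slobodeckij norm
`(∫_D ∫_D |u(y) - u(x)|^p / |y - x|^(s p + n) dx dy + ∫_D |u|^p dx)^(1/p)` of `W^{s,p}(D)`,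
with values in `[0, ∞]`. -/
noncomputable def sobolevNorm {n : ℕ} (s p : ℝ) (D : Set (EuclideanSpace ℝ (Fin n)))
    (u : EuclideanSpace ℝ (Fin n) → ℝ) : ℝ≥0∞ :=
  ((∫⁻ z in D ×ˢ D, ENNReal.ofReal (|u z.2 - u z.1| ^ p / ‖z.2 - z.1‖ ^ (s * p + n)))
    + ∫⁻ x in D, ENNReal.ofReal (|u x| ^ p)) ^ (1 / p)

/-- `u ∈ W^{s,p}(D)`. -/
def MemSobolev {n : ℕ} (s p : ℝ) (D : Set (EuclideanSpace ℝ (Fin n)))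
    (u : EuclideanSpace ℝ (Fin n) → ℝ) : Prop :=
  AEStronglyMeasurable u (volume.restrict D) ∧ sobolevNorm s p D u < ⊤

/-- `u ∈ W_0^{s,p}(D)`: the closure of `C₀^∞(D)` with respect to the norm of `W^{s,p}(D)`, each
function being extended by zero (almost everywhere) outside `D`. -/
def MemSobolevZero {n : ℕ} (s p : ℝ) (D : Set (EuclideanSpace ℝ (Fin n)))
    (u : EuclideanSpace ℝ (Fin n) → ℝ) : Prop :=
  MemSobolev s p D u ∧
  (∀ᵐ x, x ∉ D → u x = 0) ∧
  ∀ ε : ℝ≥0∞, 0 < ε → ∃ φ, IsTestFunction D φ ∧ sobolevNorm s p D (fun x => u x - φ x) < ε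

/-- The fractional Rayleigh quotient
`(∫∫ |u(y) - u(x)|^p / |y - x|^(α p) dx dy) / ∫ |u|^p dx`, all integrals over the whole space,
with values in `[0, ∞]`. -/
noncomputable def rayleigh {n : ℕ} (α p : ℝ) (u : EuclideanSpace ℝ (Fin n) → ℝ) : ℝ≥0∞ :=
  (∫⁻ z : EuclideanSpace ℝ (Fin n) × EuclideanSpace ℝ (Fin n),
      ENNReal.ofReal (|u z.2 - u z.1| ^ p / ‖z.2 - z.1‖ ^ (α * p)))
    / ∫⁻ x, ENNReal.ofReal (|u x| ^ p)

/-- The first eigenvalue `λ₁(Ω)`: the infimum of the Rayleigh quotient over the functions of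
`C₀^∞(Ω)` that do not vanish identically. -/
noncomputable def firstEigenvalue {n : ℕ} (α p : ℝ) (Ω : Set (EuclideanSpace ℝ (Fin n))) : ℝ≥0∞ :=
  ⨅ φ ∈ {φ : EuclideanSpace ℝ (Fin n) → ℝ | IsTestFunction Ω φ ∧ φ ≠ 0}, rayleigh α p φ

/-- `u` is an eigenfunction of `Ω` with eigenvalue `lam`: `u ∈ W_0^{s,p}(Ω)` with `s = α - n/p`,
`u ≢ 0` (as an element of the Sobolev space), and the weak Euler-Lagrange equation holds for all
test functions in `C₀^∞(Ω)`. -/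
structure IsEigenfunction {n : ℕ} (α p : ℝ) (Ω : Set (EuclideanSpace ℝ (Fin n))) (lam : ℝ)
    (u : EuclideanSpace ℝ (Fin n) → ℝ) : Prop where
  mem : MemSobolevZero (α - n / p) p Ω u
  ne_zero : ¬ u =ᵐ[volume] 0
  euler_lagrange : ∀ φ : EuclideanSpace ℝ (Fin n) → ℝ, IsTestFunction Ω φ →
    ∫ z : EuclideanSpace ℝ (Fin n) × EuclideanSpace ℝ (Fin n),
        |u z.2 - u z.1| ^ (p - 2) * (u z.2 - u z.1) * (φ z.2 - φ z.1) / ‖z.2 - z.1‖ ^ (α * p)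
      = lam * ∫ x, |u x| ^ (p - 2) * u x * φ x

/-- `u` minimizes the Rayleigh quotient: it is a nonzero element of `W_0^{s,p}(Ω)`,
`s = α - n/p`, at which the infimum `λ₁(Ω)` is attained, and its quotient does not exceed that of
any nonzero element of `W_0^{s,p}(Ω)`. -/
structure IsRayleighMinimizer {n : ℕ} (α p : ℝ) (Ω : Set (EuclideanSpace ℝ (Fin n)))
    (u : EuclideanSpace ℝ (Fin n) → ℝ) : Prop where
  mem : MemSobolevZero (α - n / p) p Ω u
  ne_zero : ¬ u =ᵐ[volume] 0
  attains : rayleigh α p u = firstEigenvalue α p Ω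
  le : ∀ v : EuclideanSpace ℝ (Fin n) → ℝ,
    MemSobolevZero (α - n / p) p Ω v → ¬ v =ᵐ[volume] 0 → rayleigh α p u ≤ rayleigh α p v

end FractionalEigenvalue

open Filter Topology Metric Set

namespace FractionalEigenvalue

set_option linter.unusedSectionVars false

/-! ### Fractional Hardy inequality on a proper open set -/

section Hardy

variable {E : Type*} [NormedAddCommGroup E] [NormedSpace ℝ E]

/-! Write `Du` for the difference quotient of order `α`. Testing the weak equation with `u` itself
gives `R(u) = λ`, hence `λ ≥ 0`, and `λ₁ ≤ R(u) = λ` because test functions are dense. What remains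
is `λ ≤ R(φ)` for every test function `φ`.

This comes from the discrete Picone inequality (`picone`). For `w_ε = |φ|^p (u + ε)^(1-p)` the
integrand of the weak form of `u` against `w_ε` is pointwise at most `|Dφ|^p`. Testing with `w_ε`
and letting `ε → 0` yields `λ ∫ |φ|^p ≤ ∫∫ |Dφ|^p`, provided `u > 0` almost everywhere on `{φ ≠ 0}`.
The same inequality supplies this positivity (`ae_pos_of_test_ne_zero`): the Picone defect has
integral bounded uniformly in `ε`, yet tends to infinity at every pair `(x, y)` with `u x = 0 < u y`
and `φ x ≠ 0`. The set of such pairs is a product, so one factor is null, and it is not `{u > 0}`.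

Two density statements justify inserting `u` and `w_ε` in an equation posed for smooth functions
only. Elements of `W_0^{s,p}(Ω)` are approximated in a norm that sees only `Ω × Ω`, while the
equation lives on the whole space. `exists_lintegral_kernel_le` bridges this through a Hardy
inequality, valid on every proper open set because `α p > 2 n`. For `w_ε`, which has finite energy
and compact support in `Ω`, mollification suffices (`isTestLimit_of_compact_support`). -/

theorem abs_rpow_le_two_rpow_mul {p : ℝ} (hp : 1 ≤ p) (a b : ℝ) :
    |a| ^ p ≤ 2 ^ (p - 1) * (|b - a| ^ p + |b| ^ p) := by
  have h := NNReal.rpow_add_le_mul_rpow_add_rpow ‖b - a‖₊ ‖b‖₊ hp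
  have h' : |a| ^ p ≤ (|b - a| + |b|) ^ p := by
    refine Real.rpow_le_rpow (abs_nonneg _) ?_ (by linarith)
    have := abs_sub_abs_le_abs_sub a b
    rw [abs_sub_comm] at this
    linarith
  refine h'.trans ?_
  have := NNReal.coe_le_coe.2 h
  simpa using this

/-- The set of pairs over which the difference quotient is averaged in the Hardy inequality. -/
def hardySet (Ω : Set E) (θ : ℝ) : Set (E × E) :=
  {z | z.1 ∈ Ω ∧ z.2 ∈ Ω ∧ θ / 2 * infDist z.1 Ωᶜ ≤ infDist z.2 Ωᶜ ∧
    infDist z.2 Ωᶜ ≤ 2 * θ * infDist z.1 Ωᶜ ∧ ‖z.2 - z.1‖ ≤ infDist z.1 Ωᶜ}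

variable {Ω : Set E} {θ : ℝ}

theorem measurableSet_hardySet [FiniteDimensional ℝ E] [MeasurableSpace E] [BorelSpace E]
    (hΩ : IsOpen Ω) : MeasurableSet (hardySet Ω θ) := by
  have hd : Measurable fun x : E => infDist x Ωᶜ := (continuous_infDist_pt _).measurable
  have h1 : Measurable fun z : E × E => infDist z.1 Ωᶜ := hd.comp measurable_fst
  have h2 : Measurable fun z : E × E => infDist z.2 Ωᶜ := hd.comp measurable_snd
  exact MeasurableSet.inter (measurable_fst hΩ.measurableSet)
    (MeasurableSet.inter (measurable_snd hΩ.measurableSet)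
    (MeasurableSet.inter (measurableSet_le (h1.const_mul _) h2)
    (MeasurableSet.inter (measurableSet_le h2 (h1.const_mul _))
    (measurableSet_le (by fun_prop) h1))))

theorem infDist_compl_pos {E : Type*} [NormedAddCommGroup E] {Ω : Set E} (hΩ : IsOpen Ω)
    (hne : Ωᶜ.Nonempty) {x : E} (hx : x ∈ Ω) :
    0 < infDist x Ωᶜ :=
  (hΩ.isClosed_compl.notMem_iff_infDist_pos hne).1 (by simpa using hx)

/-- With `δ` the distance to the complement, `‖y - x‖ ≤ δ(x)` exchanges the weight for the kernel,
and `δ(y) ≤ 2 θ δ(x)` exchanges the weight at `x` for the weight at `y` at the price `(2 θ) ^ q`,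
which is small with `θ`. -/
theorem hardySet_bound {p q : ℝ} (hp : 1 ≤ p) (hq : 0 < q) (hθ : 0 < θ) (hΩ : IsOpen Ω)
    (hne : Ωᶜ.Nonempty) (φ : E → ℝ) {z : E × E} (hz : z ∈ hardySet Ω θ) :
    |φ z.1| ^ p * infDist z.1 Ωᶜ ^ (-q) ≤
      2 ^ (p - 1) * (|φ z.2 - φ z.1| ^ p / ‖z.2 - z.1‖ ^ q) +
        2 ^ (p - 1) * (2 * θ) ^ q * (|φ z.2| ^ p * infDist z.2 Ωᶜ ^ (-q)) := by
  obtain ⟨h1, h2, -, h4, h5⟩ := hz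
  have d1 := infDist_compl_pos hΩ hne h1
  have d2 := infDist_compl_pos hΩ hne h2
  set a := infDist z.1 Ωᶜ
  set b := infDist z.2 Ωᶜ
  have e1 : |φ z.2 - φ z.1| ^ p * a ^ (-q) ≤ |φ z.2 - φ z.1| ^ p / ‖z.2 - z.1‖ ^ q := by
    rcases eq_or_ne z.2 z.1 with h | h
    · simp [h, Real.zero_rpow (by linarith : p ≠ 0)]
    · have hr : 0 < ‖z.2 - z.1‖ := norm_pos_iff.2 (sub_ne_zero.2 h)
      rw [Real.rpow_neg d1.le, div_eq_mul_inv]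
      gcongr
  have e2 : a ^ (-q) ≤ (2 * θ) ^ q * b ^ (-q) := by
    rw [Real.rpow_neg d1.le, Real.rpow_neg d2.le, ← div_eq_mul_inv, inv_eq_one_div,
      div_le_div_iff₀ (by positivity) (by positivity), one_mul,
      ← Real.mul_rpow (by positivity) d1.le]
    exact Real.rpow_le_rpow d2.le h4 hq.le
  calc |φ z.1| ^ p * a ^ (-q)
      ≤ 2 ^ (p - 1) * (|φ z.2 - φ z.1| ^ p + |φ z.2| ^ p) * a ^ (-q) := by
        gcongr
        exact abs_rpow_le_two_rpow_mul hp _ _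
    _ = 2 ^ (p - 1) * (|φ z.2 - φ z.1| ^ p * a ^ (-q)) + 2 ^ (p - 1) * |φ z.2| ^ p * a ^ (-q) := by
        ring
    _ ≤ 2 ^ (p - 1) * (|φ z.2 - φ z.1| ^ p / ‖z.2 - z.1‖ ^ q) +
        2 ^ (p - 1) * |φ z.2| ^ p * ((2 * θ) ^ q * b ^ (-q)) := by
        gcongr
    _ = _ := by ring

variable [FiniteDimensional ℝ E]

/-- The centre lies on the segment from `x` to a nearest point `w` of the complement, at distance `θ
δ(x)` from `w`. Its own distance to the complement is then exactly `θ δ(x)`, and half of that radius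
leaves room for all the constraints. -/
theorem ball_subset_hardySet_section (hθ : 0 < θ) (hθ1 : θ ≤ 1) (hΩ : IsOpen Ω)
    (hne : Ωᶜ.Nonempty) {x : E} (hx : x ∈ Ω) :
    ∃ c, ball c (θ / 2 * infDist x Ωᶜ) ⊆ Prod.mk x ⁻¹' hardySet Ω θ := by
  have d1 := infDist_compl_pos hΩ hne hx
  have : ProperSpace E := FiniteDimensional.proper ℝ E
  obtain ⟨w, hw, hxw⟩ := hΩ.isClosed_compl.exists_infDist_eq_dist hne x
  refine ⟨w + θ • (x - w), fun y hy => ?_⟩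
  set a := infDist x Ωᶜ
  have hy' : dist y (w + θ • (x - w)) < θ / 2 * a := hy
  have hcw : dist (w + θ • (x - w)) w = θ * a := by
    rw [dist_eq_norm, add_sub_cancel_left, norm_smul, Real.norm_of_nonneg hθ.le, hxw, dist_eq_norm]
  have hcx : dist x (w + θ • (x - w)) = (1 - θ) * a := by
    have : x - (w + θ • (x - w)) = (1 - θ) • (x - w) := by module
    rw [dist_eq_norm, this, norm_smul, Real.norm_of_nonneg (by linarith), hxw, dist_eq_norm]
  have l1 : a ≤ infDist (w + θ • (x - w)) Ωᶜ + dist x (w + θ • (x - w)) :=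
    infDist_le_infDist_add_dist
  have l2 : infDist (w + θ • (x - w)) Ωᶜ ≤ infDist y Ωᶜ + dist (w + θ • (x - w)) y :=
    infDist_le_infDist_add_dist
  rw [dist_comm] at l2
  have l3 : infDist y Ωᶜ ≤ dist y w := infDist_le_dist_of_mem hw
  have l4 := dist_triangle y (w + θ • (x - w)) w
  have l5 := dist_triangle y (w + θ • (x - w)) x
  rw [dist_comm (w + θ • (x - w)) x] at l5
  have hpos : 0 < infDist y Ωᶜ := by nlinarith
  refine ⟨hx, ?_, ?_, ?_, ?_⟩
  · by_contra h
    exact hpos.ne' (infDist_zero_of_mem h)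
  · change θ / 2 * a ≤ infDist y Ωᶜ
    nlinarith
  · change infDist y Ωᶜ ≤ 2 * θ * a
    nlinarith
  · change ‖y - x‖ ≤ a
    rw [← dist_eq_norm]
    nlinarith

variable [MeasurableSpace E] [BorelSpace E] (μ : Measure E) [μ.IsAddHaarMeasure]

theorem measure_hardySet_section_ge [Nontrivial E] (hθ : 0 < θ) (hθ1 : θ ≤ 1) (hΩ : IsOpen Ω)
    (hne : Ωᶜ.Nonempty) {x : E} (hx : x ∈ Ω) :
    ENNReal.ofReal ((θ / 2 * infDist x Ωᶜ) ^ Module.finrank ℝ E) * μ (ball 0 1) ≤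
      μ (Prod.mk x ⁻¹' hardySet Ω θ) := by
  obtain ⟨c, hc⟩ := ball_subset_hardySet_section hθ hθ1 hΩ hne hx
  rw [← Measure.addHaar_ball μ c (mul_nonneg (by positivity) infDist_nonneg)]
  exact measure_mono hc

theorem measure_hardySet_section_le (hθ : 0 < θ) (y : E) :
    μ ((fun x => (x, y)) ⁻¹' hardySet Ω θ) ≤
      ENNReal.ofReal ((2 / θ * infDist y Ωᶜ) ^ Module.finrank ℝ E) * μ (ball 0 1) := by
  rw [← Measure.addHaar_closedBall μ y (mul_nonneg (by positivity) infDist_nonneg)]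
  refine measure_mono fun x hx => ?_
  obtain ⟨-, -, h3, -, h5⟩ := hx
  simp only at h3 h5
  rw [mem_closedBall, dist_comm, dist_eq_norm]
  refine h5.trans ?_
  rw [div_mul_eq_mul_div, le_div_iff₀ hθ]
  linarith

/-- The pointwise bound is integrated over `hardySet Ω θ`. Fixing the first point gives sections of
volume at least that of a ball of radius `θ δ / 2`; fixing the second gives at most a ball of radius
`2 δ / θ`. The parameter `θ` stays free, so that the last term can later be absorbed on the left. -/
theorem fractional_hardy_aux [Nontrivial E] {p q : ℝ} (hp : 1 ≤ p) (hq : 0 < q)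
    (hθ : 0 < θ) (hθ1 : θ ≤ 1) (hΩ : IsOpen Ω) (hne : Ωᶜ.Nonempty) {φ : E → ℝ}
    (hφ : Measurable φ) :
    ENNReal.ofReal ((θ / 2) ^ Module.finrank ℝ E) * μ (ball 0 1) *
        ∫⁻ x in Ω, ENNReal.ofReal
          (|φ x| ^ p * infDist x Ωᶜ ^ (-q) * infDist x Ωᶜ ^ Module.finrank ℝ E) ∂μ ≤
      ENNReal.ofReal (2 ^ (p - 1)) *
        (∫⁻ z in Ω ×ˢ Ω, ENNReal.ofReal (|φ z.2 - φ z.1| ^ p / ‖z.2 - z.1‖ ^ q) ∂(μ.prod μ)) +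
      ENNReal.ofReal (2 ^ (p - 1) * (2 * θ) ^ q * (2 / θ) ^ Module.finrank ℝ E) * μ (ball 0 1) *
        ∫⁻ x in Ω, ENNReal.ofReal
          (|φ x| ^ p * infDist x Ωᶜ ^ (-q) * infDist x Ωᶜ ^ Module.finrank ℝ E) ∂μ := by
  set d := Module.finrank ℝ E
  set δ : E → ℝ := fun x => infDist x Ωᶜ
  have hδm : Measurable δ := (continuous_infDist_pt _).measurable
  have hδ0 : ∀ x, 0 ≤ δ x := fun x => infDist_nonneg
  set h : E → ℝ≥0∞ := fun x => ENNReal.ofReal (|φ x| ^ p * δ x ^ (-q))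
  have hh0 : ∀ x, 0 ≤ |φ x| ^ p * δ x ^ (-q) := fun x =>
    mul_nonneg (by positivity) (Real.rpow_nonneg (hδ0 x) _)
  have hhm : Measurable h := by fun_prop
  set A := hardySet Ω θ
  have hA : MeasurableSet A := measurableSet_hardySet hΩ
  have hsplit : ∀ x, ∀ c : ℝ, 0 ≤ c → ENNReal.ofReal ((c * δ x) ^ d) * h x =
      ENNReal.ofReal (c ^ d) * ENNReal.ofReal (|φ x| ^ p * δ x ^ (-q) * δ x ^ d) := by
    intro x c hc
    rw [← ENNReal.ofReal_mul (by have := hδ0 x; positivity), ← ENNReal.ofReal_mul (by positivity),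
      mul_pow]
    ring_nf
  have lower : ENNReal.ofReal ((θ / 2) ^ d) * μ (ball 0 1) *
        ∫⁻ x in Ω, ENNReal.ofReal (|φ x| ^ p * δ x ^ (-q) * δ x ^ d) ∂μ ≤
      ∫⁻ z in A, h z.1 ∂(μ.prod μ) := by
    rw [← lintegral_indicator hA, lintegral_prod _ (by
      exact ((hhm.comp measurable_fst).indicator hA).aemeasurable),
      ← lintegral_const_mul _ (by fun_prop), ← lintegral_indicator hΩ.measurableSet]
    refine lintegral_mono fun x => ?_
    have : ∀ y, A.indicator (fun z : E × E => h z.1) (x, y) =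
        (Prod.mk x ⁻¹' A).indicator (fun _ => h x) y := fun y => by
      rfl
    simp_rw [this]
    rw [lintegral_indicator (measurable_prodMk_left hA), lintegral_const]
    by_cases hx : x ∈ Ω
    · rw [indicator_of_mem hx, mul_right_comm, ← hsplit x _ (by positivity), mul_right_comm,
        Measure.restrict_apply_univ, mul_comm]
      gcongr
      exact measure_hardySet_section_ge μ hθ hθ1 hΩ hne hx
    · rw [indicator_of_notMem hx]
      exact zero_le
  have upper : ∫⁻ z in A, h z.2 ∂(μ.prod μ) ≤
      ENNReal.ofReal ((2 / θ) ^ d) * μ (ball 0 1) *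
        ∫⁻ x in Ω, ENNReal.ofReal (|φ x| ^ p * δ x ^ (-q) * δ x ^ d) ∂μ := by
    rw [← lintegral_indicator hA, lintegral_prod_symm _ (by
      exact ((hhm.comp measurable_snd).indicator hA).aemeasurable),
      ← lintegral_const_mul _ (by fun_prop), ← lintegral_indicator hΩ.measurableSet]
    refine lintegral_mono fun y => ?_
    have : ∀ x, A.indicator (fun z : E × E => h z.2) (x, y) =
        ((fun x => (x, y)) ⁻¹' A).indicator (fun _ => h y) x := fun x => by
      rfl
    simp_rw [this]
    rw [lintegral_indicator (measurable_prodMk_right hA), lintegral_const]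
    by_cases hy : y ∈ Ω
    · rw [indicator_of_mem hy, mul_right_comm _ (μ (ball 0 1)), ← hsplit y _ (by positivity),
        mul_right_comm, Measure.restrict_apply_univ, mul_comm]
      gcongr
      exact measure_hardySet_section_le μ hθ y
    · have : (fun x => (x, y)) ⁻¹' A = ∅ := by
        ext x
        simp only [mem_preimage, mem_empty_iff_false, iff_false]
        exact fun hx => hy hx.2.1
      simp [this]
  refine lower.trans ?_
  have hk : Measurable fun z : E × E =>
      ENNReal.ofReal (|φ z.2 - φ z.1| ^ p / ‖z.2 - z.1‖ ^ q) := by fun_prop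
  calc ∫⁻ z in A, h z.1 ∂(μ.prod μ)
      ≤ ∫⁻ z in A, (ENNReal.ofReal (2 ^ (p - 1)) *
            ENNReal.ofReal (|φ z.2 - φ z.1| ^ p / ‖z.2 - z.1‖ ^ q) +
          ENNReal.ofReal (2 ^ (p - 1) * (2 * θ) ^ q) * h z.2) ∂(μ.prod μ) := by
        refine setLIntegral_mono' hA fun z hz => ?_
        rw [← ENNReal.ofReal_mul (by positivity), ← ENNReal.ofReal_mul (by positivity),
          ← ENNReal.ofReal_add (by positivity) (mul_nonneg (by positivity) (hh0 _))]
        exact ENNReal.ofReal_le_ofReal (hardySet_bound hp hq hθ hΩ hne φ hz)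
    _ = ENNReal.ofReal (2 ^ (p - 1)) *
          (∫⁻ z in A, ENNReal.ofReal (|φ z.2 - φ z.1| ^ p / ‖z.2 - z.1‖ ^ q) ∂(μ.prod μ)) +
        ENNReal.ofReal (2 ^ (p - 1) * (2 * θ) ^ q) * ∫⁻ z in A, h z.2 ∂(μ.prod μ) := by
        rw [lintegral_add_left (hk.const_mul _), lintegral_const_mul _ hk,
          lintegral_const_mul _ (show Measurable fun z : E × E => h z.2 from hhm.comp measurable_snd)]
    _ ≤ _ := by
        rw [ENNReal.ofReal_mul (by positivity) (q := (2 / θ) ^ d), mul_assoc (ENNReal.ofReal _),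
          mul_assoc (ENNReal.ofReal _)]
        refine add_le_add ?_ ?_
        · gcongr
          exact fun z hz => ⟨hz.1, hz.2.1⟩
        · gcongr

/-- This a priori finiteness makes the absorption legitimate in `ℝ≥0∞`: the weight is singular only
at the boundary, away from the support of `φ`. -/
theorem lintegral_hardy_lt_top {p q : ℝ} (hp : 0 ≤ p) (hΩ : IsOpen Ω)
    (hne : Ωᶜ.Nonempty) {φ : E → ℝ} (hφ : Continuous φ) (hφc : HasCompactSupport φ)
    (hφΩ : tsupport φ ⊆ Ω) (hp0 : p ≠ 0) :
    ∫⁻ x in Ω, ENNReal.ofReal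
      (|φ x| ^ p * infDist x Ωᶜ ^ (-q) * infDist x Ωᶜ ^ Module.finrank ℝ E) ∂μ < ⊤ := by
  set f : E → ℝ := fun x => |φ x| ^ p * infDist x Ωᶜ ^ (-q) * infDist x Ωᶜ ^ Module.finrank ℝ E
  have hf : ContinuousOn f (tsupport φ) := by
    have hδ : Continuous fun x : E => infDist x Ωᶜ := continuous_infDist_pt _
    refine ((hφ.abs.rpow_const fun _ => Or.inr hp).continuousOn.mul ?_).mul
      (hδ.pow _).continuousOn
    exact hδ.continuousOn.rpow_const fun x hx =>
      Or.inl (infDist_compl_pos hΩ hne (hφΩ hx)).ne'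
  refine lt_of_le_of_lt ?_ (hf.integrableOn_compact (μ := μ) hφc).lintegral_lt_top
  rw [← lintegral_indicator (isClosed_tsupport φ).measurableSet]
  refine (setLIntegral_le_lintegral _ _).trans (lintegral_mono fun x => ?_)
  by_cases hx : x ∈ tsupport φ
  · rw [indicator_of_mem hx]
  · simp [f, image_eq_zero_of_notMem_tsupport hx, Real.zero_rpow hp0]

/-- The fractional Hardy inequality for functions compactly supported in an arbitrary proper open
set, with the seminorm over the set itself; `q` is the full exponent of the kernel. -/
theorem fractional_hardy [Nontrivial E] {p q : ℝ} (hp : 1 ≤ p)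
    (hq : 2 * (Module.finrank ℝ E : ℝ) < q) (hΩ : IsOpen Ω) (hne : Ωᶜ.Nonempty) :
    ∃ C : ℝ≥0∞, C ≠ ⊤ ∧ ∀ φ : E → ℝ, Continuous φ → HasCompactSupport φ → tsupport φ ⊆ Ω →
      ∫⁻ x in Ω, ENNReal.ofReal
        (|φ x| ^ p * infDist x Ωᶜ ^ (-q) * infDist x Ωᶜ ^ Module.finrank ℝ E) ∂μ ≤
      C * ∫⁻ z in Ω ×ˢ Ω, ENNReal.ofReal (|φ z.2 - φ z.1| ^ p / ‖z.2 - z.1‖ ^ q) ∂(μ.prod μ) := by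
  set d := Module.finrank ℝ E
  have hq0 : 0 < q := lt_of_le_of_lt (by positivity) hq
  -- The coefficient on the right scales like `θ ^ (q - d)`, that on the left like `θ ^ d`, so `q >
  -- 2 d` lets a small `θ` win. This exponent makes the right coefficient exactly half of the left
  -- one.
  set r := (p + q + 2 * d) / (q - 2 * d)
  have hr : 0 ≤ r := div_nonneg (by positivity) (by linarith)
  set θ : ℝ := 2 ^ (-r)
  have hθ : 0 < θ := by positivity
  have hθ1 : θ ≤ 1 := Real.rpow_le_one_of_one_le_of_nonpos (by norm_num) (by linarith)
  have key : 2 ^ (p - 1) * (2 * θ) ^ q * (2 / θ) ^ d = (θ / 2) ^ d / 2 := by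
    have e1 : θ ^ q = 2 ^ (-(p + q + 2 * d)) * θ ^ d * θ ^ d := by
      rw [← Real.rpow_natCast θ d, mul_assoc, ← Real.rpow_add hθ, ← Real.rpow_mul (by norm_num),
        ← Real.rpow_mul (by norm_num), ← Real.rpow_add (by norm_num)]
      congr 1
      have : q - 2 * d ≠ 0 := by linarith
      simp only [r]
      field_simp
      ring
    rw [Real.mul_rpow (by norm_num) hθ.le, e1, div_pow, div_pow, Real.rpow_neg (by norm_num),
      Real.rpow_add (by norm_num), Real.rpow_add (by norm_num), Real.rpow_sub_one (by norm_num),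
      Real.rpow_mul (by norm_num), Real.rpow_natCast]
    have : (2 : ℝ) ^ (2 : ℝ) = 2 * 2 := by norm_num
    rw [this, mul_pow]
    field_simp
  set v := μ (ball (0 : E) 1)
  have hv0 : v ≠ 0 := (measure_ball_pos μ 0 one_pos).ne'
  have hvt : v ≠ ⊤ := measure_ball_lt_top.ne
  set c := ENNReal.ofReal ((θ / 2) ^ d / 2)
  have hc0 : c ≠ 0 := by
    simp only [c, ne_eq, ENNReal.ofReal_eq_zero, not_le]
    positivity
  have hct : c ≠ ⊤ := ENNReal.ofReal_ne_top
  refine ⟨(c * v)⁻¹ * ENNReal.ofReal (2 ^ (p - 1)), ENNReal.mul_ne_top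
    (ENNReal.inv_ne_top.2 (mul_ne_zero hc0 hv0)) ENNReal.ofReal_ne_top, fun φ h1 h2 h3 => ?_⟩
  have aux := fractional_hardy_aux μ hp hq0 hθ hθ1 hΩ hne h1.measurable
  have fin := lintegral_hardy_lt_top μ (p := p) (q := q) (by linarith) hΩ hne h1 h2 h3 (by linarith)
  rw [key] at aux
  set I := ∫⁻ x in Ω, ENNReal.ofReal (|φ x| ^ p * infDist x Ωᶜ ^ (-q) * infDist x Ωᶜ ^ d) ∂μ
  have e2 : ENNReal.ofReal ((θ / 2) ^ d) = c + c := by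
    rw [← ENNReal.ofReal_add (by positivity) (by positivity), add_halves]
  rw [e2, add_mul, add_mul, add_comm (ENNReal.ofReal _ * _)] at aux
  have aux' := ENNReal.le_of_add_le_add_left
    (ENNReal.mul_ne_top (ENNReal.mul_ne_top hct hvt) fin.ne) aux
  rw [mul_assoc, ← ENNReal.inv_mul_le_iff, inv_inv]
  · exact aux'
  · exact ENNReal.inv_ne_zero.2 (ENNReal.mul_ne_top hct hvt)
  · exact ENNReal.inv_ne_top.2 (mul_ne_zero hc0 hv0)

/-- The tail of the kernel `‖y - x‖ ^ (-q)` outside of a ball around `x`. -/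
theorem exists_lintegral_norm_rpow_le {q : ℝ} (hq : (Module.finrank ℝ E : ℝ) < q) :
    ∃ C : ℝ≥0∞, C ≠ ⊤ ∧ ∀ (x : E) (r : ℝ), 0 < r →
      ∫⁻ y in {y | r ≤ ‖y - x‖}, ENNReal.ofReal (‖y - x‖ ^ (-q)) ∂μ ≤
        C * ENNReal.ofReal (r ^ (-q) * r ^ Module.finrank ℝ E) := by
  have hq0 : 0 < q := lt_of_le_of_lt (by positivity) hq
  set I := ∫⁻ y : E, ENNReal.ofReal ((1 + ‖y‖) ^ (-q)) ∂μ
  have hI : I < ⊤ := finite_integral_one_add_norm hq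
  refine ⟨ENNReal.ofReal (2 ^ q) * I, ENNReal.mul_ne_top ENNReal.ofReal_ne_top hI.ne,
    fun x r hr => ?_⟩
  have hm : Measurable fun y : E => ENNReal.ofReal ((1 + ‖y‖) ^ (-q)) := by fun_prop
  have scale : ∫⁻ y : E, ENNReal.ofReal ((1 + ‖r⁻¹ • y‖) ^ (-q)) ∂μ =
      ENNReal.ofReal (r ^ Module.finrank ℝ E) * I := by
    rw [← lintegral_map (f := fun y : E => ENNReal.ofReal ((1 + ‖y‖) ^ (-q))) hm
      (measurable_const_smul r⁻¹), Measure.map_addHaar_smul μ (inv_ne_zero hr.ne'),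
      lintegral_smul_measure]
    rw [inv_pow, inv_inv, abs_of_pos (by positivity), smul_eq_mul]
  have trans : ∫⁻ y, ENNReal.ofReal ((1 + ‖r⁻¹ • (y - x)‖) ^ (-q)) ∂μ =
      ∫⁻ y : E, ENNReal.ofReal ((1 + ‖r⁻¹ • y‖) ^ (-q)) ∂μ :=
    lintegral_sub_right_eq_self (fun y : E => ENNReal.ofReal ((1 + ‖r⁻¹ • y‖) ^ (-q))) x
  -- For `‖y - x‖ ≥ r` one has `1 + ‖y - x‖ / r ≤ 2 ‖y - x‖ / r`, so the tail is dominated by a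
  -- rescaled, translated copy of the integrable function `(1 + ‖y‖) ^ (-q)`.
  calc ∫⁻ y in {y | r ≤ ‖y - x‖}, ENNReal.ofReal (‖y - x‖ ^ (-q)) ∂μ
      ≤ ∫⁻ y in {y | r ≤ ‖y - x‖}, ENNReal.ofReal (2 ^ q * r ^ (-q)) *
          ENNReal.ofReal ((1 + ‖r⁻¹ • (y - x)‖) ^ (-q)) ∂μ := by
        refine setLIntegral_mono' (measurableSet_le measurable_const (by fun_prop))
          fun y (hy : r ≤ ‖y - x‖) => ?_
        rw [← ENNReal.ofReal_mul (by positivity)]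
        refine ENNReal.ofReal_le_ofReal ?_
        have hpos : 0 < ‖y - x‖ := hr.trans_le hy
        have : (2 : ℝ) ^ q = 2⁻¹ ^ (-q) := by rw [Real.inv_rpow two_pos.le, Real.rpow_neg two_pos.le,
          inv_inv]
        rw [this, ← Real.mul_rpow (by positivity) (by positivity),
          ← Real.mul_rpow (by positivity) (by positivity), norm_smul, norm_inv,
          Real.norm_of_nonneg hr.le]
        refine Real.rpow_le_rpow_of_nonpos (by positivity) ?_ (by linarith)
        have : r * (r⁻¹ * ‖y - x‖) = ‖y - x‖ := by field_simp
        nlinarith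
    _ ≤ ∫⁻ y, ENNReal.ofReal (2 ^ q * r ^ (-q)) *
          ENNReal.ofReal ((1 + ‖r⁻¹ • (y - x)‖) ^ (-q)) ∂μ := setLIntegral_le_lintegral _ _
    _ = ENNReal.ofReal (2 ^ q * r ^ (-q)) * (ENNReal.ofReal (r ^ Module.finrank ℝ E) * I) := by
        rw [lintegral_const_mul _ (by fun_prop), trans, scale]
    _ = _ := by
        rw [ENNReal.ofReal_mul (by positivity), ENNReal.ofReal_mul (by positivity)]
        ring

end Hardy

/-! ### Gagliardo energies as `L^p` norms of difference quotients -/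

section DiffQuot

variable {E : Type*} [NormedAddCommGroup E] {α p : ℝ}

/-- The fractional difference quotient of order `α`. -/
noncomputable def diffQuot (α : ℝ) (u : E → ℝ) (z : E × E) : ℝ :=
  (u z.2 - u z.1) / ‖z.2 - z.1‖ ^ α

theorem diffQuot_sub (α : ℝ) (u v : E → ℝ) :
    diffQuot α (u - v) = diffQuot α u - diffQuot α v := by
  ext z
  simp only [diffQuot, Pi.sub_apply]
  ring

theorem ofReal_kernel_eq (hp : 0 < p) (u : E → ℝ) (z : E × E) :
    ENNReal.ofReal (|u z.2 - u z.1| ^ p / ‖z.2 - z.1‖ ^ (α * p)) = ‖diffQuot α u z‖ₑ ^ p := by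
  rw [Real.enorm_eq_ofReal_abs, ENNReal.ofReal_rpow_of_nonneg (abs_nonneg _) hp.le, diffQuot,
    abs_div, Real.div_rpow (abs_nonneg _) (abs_nonneg _),
    abs_of_nonneg (Real.rpow_nonneg (norm_nonneg _) α), ← Real.rpow_mul (norm_nonneg _)]

theorem eLpNorm_ofReal_rpow {X : Type*} [MeasurableSpace X] (hp : 0 < p) (f : X → ℝ)
    (ν : Measure X) : eLpNorm f (ENNReal.ofReal p) ν ^ p = ∫⁻ x, ‖f x‖ₑ ^ p ∂ν := by
  rw [eLpNorm_eq_lintegral_rpow_enorm_toReal (by simpa using hp) ENNReal.ofReal_ne_top,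
    ENNReal.toReal_ofReal hp.le, ← ENNReal.rpow_mul, one_div, inv_mul_cancel₀ hp.ne',
    ENNReal.rpow_one]

variable [MeasurableSpace E] [BorelSpace E]

theorem lintegral_kernel_eq (hp : 0 < p) (u : E → ℝ) (ν : Measure (E × E)) :
    ∫⁻ z, ENNReal.ofReal (|u z.2 - u z.1| ^ p / ‖z.2 - z.1‖ ^ (α * p)) ∂ν =
      eLpNorm (diffQuot α u) (ENNReal.ofReal p) ν ^ p := by
  rw [eLpNorm_ofReal_rpow hp]
  exact lintegral_congr fun z => ofReal_kernel_eq hp u z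

theorem lintegral_abs_rpow_eq (hp : 0 < p) (u : E → ℝ) (ν : Measure E) :
    ∫⁻ x, ENNReal.ofReal (|u x| ^ p) ∂ν = eLpNorm u (ENNReal.ofReal p) ν ^ p := by
  rw [eLpNorm_ofReal_rpow hp]
  refine lintegral_congr fun x => ?_
  rw [Real.enorm_eq_ofReal_abs, ENNReal.ofReal_rpow_of_nonneg (abs_nonneg _) hp.le]

variable (μ : Measure E) [SFinite μ]

theorem diffQuot_congr_ae {u v : E → ℝ} (h : u =ᵐ[μ] v) :
    diffQuot α u =ᵐ[μ.prod μ] diffQuot α v := by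
  filter_upwards [Measure.quasiMeasurePreserving_fst.ae h,
    Measure.quasiMeasurePreserving_snd.ae h] with z h1 h2
  simp [diffQuot, h1, h2]

theorem measurable_diffQuot [SecondCountableTopology E] {u : E → ℝ} (hu : Measurable u) :
    Measurable (diffQuot α u) := by
  unfold diffQuot
  fun_prop

theorem aestronglyMeasurable_diffQuot [SecondCountableTopology E] {u : E → ℝ}
    (hu : AEStronglyMeasurable u μ) : AEStronglyMeasurable (diffQuot α u) (μ.prod μ) :=
  ⟨_, (measurable_diffQuot hu.stronglyMeasurable_mk.measurable).stronglyMeasurable,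
    diffQuot_congr_ae μ hu.ae_eq_mk⟩

theorem tendsto_diffQuot_ae {u : E → ℝ} {v : ℕ → E → ℝ}
    (h : ∀ᵐ x ∂μ, Tendsto (fun k => v k x) atTop (𝓝 (u x))) :
    ∀ᵐ z ∂(μ.prod μ), Tendsto (fun k => diffQuot α (v k) z) atTop (𝓝 (diffQuot α u z)) := by
  filter_upwards [Measure.quasiMeasurePreserving_fst.ae h,
    Measure.quasiMeasurePreserving_snd.ae h] with z h1 h2
  exact (h2.sub h1).div_const _

end DiffQuot

/-! ### From the energy over `Ω × Ω` to the energy over the whole space -/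

section Extension

variable {E : Type*} [NormedAddCommGroup E] [NormedSpace ℝ E] [FiniteDimensional ℝ E]
  [MeasurableSpace E] [BorelSpace E] (μ : Measure E) [μ.IsAddHaarMeasure] {Ω : Set E}

/-- For `x ∈ Ω` and `y ∉ Ω` the numerator is `|φ x| ^ p` and `‖y - x‖ ≥ δ(x)`. Integrating the
kernel tail in `y` leaves precisely the Hardy weight. -/
theorem exists_lintegral_kernel_compl_le {p q : ℝ}
    (hq : (Module.finrank ℝ E : ℝ) < q) (hΩ : IsOpen Ω) (hne : Ωᶜ.Nonempty) :
    ∃ C : ℝ≥0∞, C ≠ ⊤ ∧ ∀ φ : E → ℝ, Measurable φ → (∀ x ∉ Ω, φ x = 0) →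
      ∫⁻ z, (Ω ×ˢ Ωᶜ).indicator
        (fun z : E × E => ENNReal.ofReal (|φ z.2 - φ z.1| ^ p / ‖z.2 - z.1‖ ^ q)) z ∂(μ.prod μ) ≤
      C * ∫⁻ x in Ω, ENNReal.ofReal
        (|φ x| ^ p * infDist x Ωᶜ ^ (-q) * infDist x Ωᶜ ^ Module.finrank ℝ E) ∂μ := by
  obtain ⟨C, hC, htail⟩ := exists_lintegral_norm_rpow_le μ hq
  refine ⟨C, hC, fun φ hφ h0 => ?_⟩
  have hm : Measurable fun z : E × E =>
      ENNReal.ofReal (|φ z.2 - φ z.1| ^ p / ‖z.2 - z.1‖ ^ q) := by fun_prop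
  have hδm : Measurable fun x => infDist x Ωᶜ := (continuous_infDist_pt _).measurable
  have hΩ2 := hΩ.measurableSet.prod hΩ.measurableSet.compl
  rw [lintegral_prod _ (hm.indicator hΩ2).aemeasurable, ← lintegral_const_mul _ (by fun_prop),
    ← lintegral_indicator hΩ.measurableSet]
  refine lintegral_mono fun x => ?_
  by_cases hx : x ∈ Ω
  · rw [indicator_of_mem hx]
    have hδ := infDist_compl_pos hΩ hne hx
    calc ∫⁻ y, (Ω ×ˢ Ωᶜ).indicator
          (fun z : E × E => ENNReal.ofReal (|φ z.2 - φ z.1| ^ p / ‖z.2 - z.1‖ ^ q)) (x, y) ∂μ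
        ≤ ∫⁻ y in {y | infDist x Ωᶜ ≤ ‖y - x‖},
            ENNReal.ofReal (|φ x| ^ p) * ENNReal.ofReal (‖y - x‖ ^ (-q)) ∂μ := by
          rw [← lintegral_indicator (measurableSet_le measurable_const (by fun_prop))]
          refine lintegral_mono fun y => ?_
          by_cases hy : y ∈ Ω
          · rw [indicator_of_notMem (fun h => h.2 hy)]
            exact zero_le
          · have hmem : y ∈ {y | infDist x Ωᶜ ≤ ‖y - x‖} := by
              rw [mem_ofPred_eq, ← dist_eq_norm, dist_comm]
              exact infDist_le_dist_of_mem hy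
            have hmem' : (x, y) ∈ Ω ×ˢ Ωᶜ := ⟨hx, hy⟩
            rw [indicator_of_mem hmem', indicator_of_mem hmem,
              ← ENNReal.ofReal_mul (by positivity)]
            simp only
            rw [h0 y hy, zero_sub, abs_neg, Real.rpow_neg (norm_nonneg _), div_eq_mul_inv]
      _ ≤ ENNReal.ofReal (|φ x| ^ p) *
            (C * ENNReal.ofReal (infDist x Ωᶜ ^ (-q) * infDist x Ωᶜ ^ Module.finrank ℝ E)) := by
          rw [lintegral_const_mul _ (by fun_prop)]
          gcongr
          exact htail x _ hδ
      _ = _ := by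
          have := ENNReal.ofReal_mul (p := |φ x| ^ p)
            (q := infDist x Ωᶜ ^ (-q) * infDist x Ωᶜ ^ Module.finrank ℝ E) (by positivity)
          rw [← mul_assoc (|φ x| ^ p)] at this
          rw [this]
          ring
  · have : ∀ y, (Ω ×ˢ Ωᶜ).indicator
        (fun z : E × E => ENNReal.ofReal (|φ z.2 - φ z.1| ^ p / ‖z.2 - z.1‖ ^ q)) (x, y) = 0 :=
      fun y => indicator_of_notMem (fun h => hx h.1) _
    simp [this]

/-- For functions compactly supported in a proper open set, the seminorm over the whole space is
controlled by the seminorm over the set. -/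
theorem exists_lintegral_kernel_le [Nontrivial E] {p q : ℝ} (hp : 1 ≤ p)
    (hq : 2 * (Module.finrank ℝ E : ℝ) < q) (hΩ : IsOpen Ω) (hne : Ωᶜ.Nonempty) :
    ∃ C : ℝ≥0∞, C ≠ ⊤ ∧ ∀ φ : E → ℝ, Continuous φ → HasCompactSupport φ → tsupport φ ⊆ Ω →
      ∫⁻ z, ENNReal.ofReal (|φ z.2 - φ z.1| ^ p / ‖z.2 - z.1‖ ^ q) ∂(μ.prod μ) ≤
      C * ∫⁻ z in Ω ×ˢ Ω, ENNReal.ofReal (|φ z.2 - φ z.1| ^ p / ‖z.2 - z.1‖ ^ q) ∂(μ.prod μ) := by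
  obtain ⟨C₁, hC₁, h₁⟩ := fractional_hardy μ hp hq hΩ hne
  have hd : (0 : ℝ) ≤ Module.finrank ℝ E := by positivity
  obtain ⟨C₂, hC₂, h₂⟩ := exists_lintegral_kernel_compl_le μ (p := p) (q := q)
    (by linarith) hΩ hne
  refine ⟨1 + 2 * (C₂ * C₁), by finiteness, fun φ hφ hc hs => ?_⟩
  set k : E × E → ℝ≥0∞ := fun z => ENNReal.ofReal (|φ z.2 - φ z.1| ^ p / ‖z.2 - z.1‖ ^ q)
  have h0 : ∀ x ∉ Ω, φ x = 0 := fun x hx => image_eq_zero_of_notMem_tsupport fun h => hx (hs h)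
  have hk : Measurable k := by
    have := hφ.measurable
    fun_prop
  have hk2 : Measurable ((Ω ×ˢ Ωᶜ).indicator k) :=
    hk.indicator (hΩ.measurableSet.prod hΩ.measurableSet.compl)
  have hk1 : Measurable ((Ω ×ˢ Ω).indicator k) :=
    hk.indicator (hΩ.measurableSet.prod hΩ.measurableSet)
  -- The two mixed regions are exchanged by swapping the points, under which the kernel is
  -- symmetric; pairs outside `Ω` in both points contribute nothing.
  have hpt : ∀ z, k z ≤ (Ω ×ˢ Ω).indicator k z +
      ((Ω ×ˢ Ωᶜ).indicator k z + (Ω ×ˢ Ωᶜ).indicator k z.swap) := by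
    rintro ⟨x, y⟩
    by_cases hx : x ∈ Ω <;> by_cases hy : y ∈ Ω
    · simp [indicator, hx, hy]
    · simp [indicator, hx, hy]
    · simp only [indicator, mem_prod, hx, hy, mem_compl_iff, Prod.swap, k]
      simp [abs_sub_comm (φ x), norm_sub_rev x]
    · simp [k, h0 x hx, h0 y hy, Real.zero_rpow (by linarith : p ≠ 0)]
  have hswap : ∫⁻ z, (Ω ×ˢ Ωᶜ).indicator k z.swap ∂(μ.prod μ) =
      ∫⁻ z, (Ω ×ˢ Ωᶜ).indicator k z ∂(μ.prod μ) := lintegral_prod_swap _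
  calc ∫⁻ z, k z ∂(μ.prod μ)
      ≤ ∫⁻ z, ((Ω ×ˢ Ω).indicator k z +
          ((Ω ×ˢ Ωᶜ).indicator k z + (Ω ×ˢ Ωᶜ).indicator k z.swap)) ∂(μ.prod μ) :=
        lintegral_mono hpt
    _ = (∫⁻ z in Ω ×ˢ Ω, k z ∂(μ.prod μ)) +
          2 * ∫⁻ z, (Ω ×ˢ Ωᶜ).indicator k z ∂(μ.prod μ) := by
        rw [lintegral_add_left hk1, lintegral_add_left hk2, hswap, two_mul,
          lintegral_indicator (hΩ.measurableSet.prod hΩ.measurableSet)]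
    _ ≤ (∫⁻ z in Ω ×ˢ Ω, k z ∂(μ.prod μ)) +
          2 * (C₂ * (C₁ * ∫⁻ z in Ω ×ˢ Ω, k z ∂(μ.prod μ))) := by
        gcongr
        exact (h₂ φ hφ.measurable h0).trans (by gcongr; exact h₁ φ hφ hc hs)
    _ = _ := by ring

end Extension

/-! ### Density of test functions in the whole-space norm -/

section TestLimit

variable {n : ℕ} {α p : ℝ} {Ω : Set (EuclideanSpace ℝ (Fin n))}
  {u : EuclideanSpace ℝ (Fin n) → ℝ}

/-- `u` is a limit of functions in `C₀^∞(Ω)` with respect to the norm over the whole space. -/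
def IsTestLimit (α p : ℝ) (Ω : Set (EuclideanSpace ℝ (Fin n)))
    (u : EuclideanSpace ℝ (Fin n) → ℝ) : Prop :=
  ∀ ε : ℝ≥0∞, 0 < ε → ∃ φ, IsTestFunction Ω φ ∧
    eLpNorm (u - φ) (ENNReal.ofReal p) volume ≤ ε ∧
    eLpNorm (diffQuot α u - diffQuot α φ) (ENNReal.ofReal p) volume ≤ ε

theorem sobolevNorm_eq (hp : 0 < p) (D : Set (EuclideanSpace ℝ (Fin n)))
    (u : EuclideanSpace ℝ (Fin n) → ℝ) :
    sobolevNorm (α - n / p) p D u =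
      (eLpNorm (diffQuot α u) (ENNReal.ofReal p) (volume.restrict (D ×ˢ D)) ^ p +
        eLpNorm u (ENNReal.ofReal p) (volume.restrict D) ^ p) ^ (1 / p) := by
  have : (α - n / p) * p + n = α * p := by field_simp; ring
  rw [sobolevNorm, this, lintegral_kernel_eq hp, lintegral_abs_rpow_eq hp]

theorem eLpNorm_diffQuot_le_sobolevNorm (hp : 0 < p) (D : Set (EuclideanSpace ℝ (Fin n)))
    (u : EuclideanSpace ℝ (Fin n) → ℝ) :
    eLpNorm (diffQuot α u) (ENNReal.ofReal p) (volume.restrict (D ×ˢ D)) ≤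
      sobolevNorm (α - n / p) p D u := by
  rw [sobolevNorm_eq hp, one_div, ENNReal.le_rpow_inv_iff hp]
  exact le_self_add

theorem eLpNorm_le_sobolevNorm (hp : 0 < p) (D : Set (EuclideanSpace ℝ (Fin n)))
    (u : EuclideanSpace ℝ (Fin n) → ℝ) :
    eLpNorm u (ENNReal.ofReal p) (volume.restrict D) ≤ sobolevNorm (α - n / p) p D u := by
  rw [sobolevNorm_eq hp, one_div, ENNReal.le_rpow_inv_iff hp]
  exact le_add_self

theorem IsTestFunction.eq_zero {φ : EuclideanSpace ℝ (Fin n) → ℝ} (h : IsTestFunction Ω φ)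
    {x : EuclideanSpace ℝ (Fin n)} (hx : x ∉ Ω) : φ x = 0 :=
  image_eq_zero_of_notMem_tsupport fun h' => hx (h.2.2 h')

theorem IsTestFunction.continuous {φ : EuclideanSpace ℝ (Fin n) → ℝ} (h : IsTestFunction Ω φ) :
    Continuous φ := h.1.continuous

theorem IsTestFunction.sub {φ ψ : EuclideanSpace ℝ (Fin n) → ℝ} (h : IsTestFunction Ω φ)
    (h' : IsTestFunction Ω ψ) : IsTestFunction Ω (φ - ψ) :=
  ⟨h.1.sub h'.1, h.2.1.sub h'.2.1, (tsupport_sub φ ψ).trans (union_subset h.2.2 h'.2.2)⟩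

theorem IsTestFunction.memLp {φ : EuclideanSpace ℝ (Fin n) → ℝ} (h : IsTestFunction Ω φ)
    (q : ℝ≥0∞) : MemLp φ q volume :=
  h.continuous.memLp_of_hasCompactSupport h.2.1

theorem exists_eLpNorm_diffQuot_le (hn : 1 ≤ n) (hp : 1 ≤ p) (hα : 2 * (n : ℝ) < α * p)
    (hΩ : IsOpen Ω) (hne : Ωᶜ.Nonempty) :
    ∃ C : ℝ≥0∞, C ≠ ⊤ ∧ ∀ φ, IsTestFunction Ω φ →
      eLpNorm (diffQuot α φ) (ENNReal.ofReal p) volume ≤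
        C * eLpNorm (diffQuot α φ) (ENNReal.ofReal p) (volume.restrict (Ω ×ˢ Ω)) := by
  have : Nonempty (Fin n) := ⟨⟨0, hn⟩⟩
  have hp0 : 0 < p := by linarith
  obtain ⟨C, hC, h⟩ := exists_lintegral_kernel_le (volume : Measure (EuclideanSpace ℝ (Fin n)))
    (q := α * p) hp (by simpa using hα) hΩ hne
  refine ⟨C ^ (1 / p), by finiteness, fun φ hφ => ?_⟩
  have := h φ hφ.continuous hφ.2.1 hφ.2.2
  rw [lintegral_kernel_eq hp0, lintegral_kernel_eq hp0] at this
  rw [← ENNReal.rpow_le_rpow_iff hp0, ENNReal.mul_rpow_of_nonneg _ _ hp0.le, ← ENNReal.rpow_mul,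
    one_div, inv_mul_cancel₀ hp0.ne', ENNReal.rpow_one]
  exact this

theorem MemSobolevZero.aestronglyMeasurable {s : ℝ} (hΩ : MeasurableSet Ω)
    (hu : MemSobolevZero s p Ω u) : AEStronglyMeasurable u volume := by
  obtain ⟨⟨hm, -⟩, h0, -⟩ := hu
  have hc : AEStronglyMeasurable u (volume.restrict Ωᶜ) := by
    refine AEStronglyMeasurable.congr (f := fun _ => 0) aestronglyMeasurable_const ?_
    rw [EventuallyEq, ae_restrict_iff' hΩ.compl]
    filter_upwards [h0] with x hx hx'
    exact (hx hx').symm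
  have := hm.add_measure hc
  rwa [Measure.restrict_add_restrict_compl hΩ] at this

theorem eLpNorm_restrict_eq_of_ae_zero {X : Type*} [MeasurableSpace X] {ν : Measure X} {s : Set X}
    {q : ℝ≥0∞} (hs : MeasurableSet s) {f : X → ℝ} (h : ∀ᵐ x ∂ν, x ∉ s → f x = 0) :
    eLpNorm f q (ν.restrict s) = eLpNorm f q ν := by
  rw [← eLpNorm_indicator_eq_eLpNorm_restrict hs]
  refine eLpNorm_congr_ae ?_
  filter_upwards [h] with x hx
  by_cases hxs : x ∈ s
  · rw [indicator_of_mem hxs]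
  · rw [indicator_of_notMem hxs, hx hxs]

/-- The extension inequality applies to differences of test functions, not directly to `u - φ k`.
Along an almost everywhere convergent subsequence, Fatou transfers it to the limit. -/
theorem MemSobolevZero.isTestLimit (hn : 1 ≤ n) (hp : 1 ≤ p) (hα : 2 * (n : ℝ) < α * p)
    (hΩ : IsOpen Ω) (hne : Ωᶜ.Nonempty) (hu : MemSobolevZero (α - n / p) p Ω u) :
    IsTestLimit α p Ω u := by
  have hp0 : 0 < p := by linarith
  have hP : 1 ≤ ENNReal.ofReal p := by simpa using hp
  have hum := hu.aestronglyMeasurable hΩ.measurableSet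
  obtain ⟨C, hC, hext⟩ := exists_eLpNorm_diffQuot_le hn hp hα hΩ hne
  choose φ hφ hφs using fun k : ℕ => hu.2.2 (ENNReal.ofReal (1 / (k + 1))) (by
    rw [ENNReal.ofReal_pos]; positivity)
  change ∀ k, sobolevNorm (α - n / p) p Ω (u - φ k) < _ at hφs
  have hlim : Tendsto (fun k : ℕ => ENNReal.ofReal (1 / ((k : ℝ) + 1))) atTop (𝓝 0) := by
    rw [← ENNReal.ofReal_zero]
    exact ENNReal.tendsto_ofReal tendsto_one_div_add_atTop_nhds_zero_nat
  have hLp : ∀ k, eLpNorm (u - φ k) (ENNReal.ofReal p) volume ≤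
      ENNReal.ofReal (1 / ((k : ℝ) + 1)) := fun k => by
    rw [← eLpNorm_restrict_eq_of_ae_zero hΩ.measurableSet]
    · exact (eLpNorm_le_sobolevNorm hp0 _ _).trans (hφs k).le
    · filter_upwards [hu.2.1] with x hx hx'
      rw [Pi.sub_apply, hx hx', (hφ k).eq_zero hx', sub_zero]
  have hmeas : TendstoInMeasure volume φ atTop u := by
    refine tendstoInMeasure_of_tendsto_eLpNorm (p := ENNReal.ofReal p) (by simpa using hp0)
      (fun k => (hφ k).continuous.aestronglyMeasurable) hum ?_
    refine tendsto_of_tendsto_of_tendsto_of_le_of_le tendsto_const_nhds hlim (fun _ => zero_le)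
      fun k => ?_
    rw [eLpNorm_sub_comm]
    exact hLp k
  obtain ⟨ns, hns, hae⟩ := hmeas.exists_seq_tendsto_ae
  have hDm : ∀ v : EuclideanSpace ℝ (Fin n) → ℝ, AEStronglyMeasurable v volume →
      AEStronglyMeasurable (diffQuot α v) volume := fun v hv =>
    aestronglyMeasurable_diffQuot volume hv
  have hDu : ∀ k, eLpNorm (diffQuot α u - diffQuot α (φ k)) (ENNReal.ofReal p) volume ≤
      C * (ENNReal.ofReal (1 / ((k : ℝ) + 1)) + ENNReal.ofReal (1 / ((k : ℝ) + 1))) := fun k => by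
    have hFatou := Lp.eLpNorm_lim_le_liminf_eLpNorm (p := ENNReal.ofReal p) (μ := volume)
      (f := fun j => diffQuot α (φ (ns j)) - diffQuot α (φ k))
      (fun j => (hDm _ (hφ _).continuous.aestronglyMeasurable).sub
        (hDm _ (hφ _).continuous.aestronglyMeasurable)) (diffQuot α u - diffQuot α (φ k)) (by
        filter_upwards [tendsto_diffQuot_ae (α := α) volume hae] with z hz
        exact hz.sub_const _)
    refine hFatou.trans (liminf_le_of_frequently_le' (Eventually.frequently ?_))
    filter_upwards [eventually_ge_atTop k] with j hj
    rw [← diffQuot_sub]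
    refine (hext _ ((hφ _).sub (hφ _))).trans ?_
    gcongr
    -- Inserting `u` bounds the difference by two approximation errors in the norm over `Ω`, and `ns
    -- j ≥ k` makes both at most `1 / (k + 1)`.
    have : diffQuot α (φ (ns j) - φ k) = diffQuot α (u - φ k) - diffQuot α (u - φ (ns j)) := by
      simp only [diffQuot_sub]
      abel
    rw [this]
    have hm : ∀ i, AEStronglyMeasurable (diffQuot α (u - φ i)) (volume.restrict (Ω ×ˢ Ω)) :=
      fun i => (hDm _ (hum.sub (hφ i).continuous.aestronglyMeasurable)).restrict
    refine (eLpNorm_sub_le (hm _) (hm _) hP).trans (add_le_add ?_ ?_)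
    · exact (eLpNorm_diffQuot_le_sobolevNorm hp0 _ _).trans (hφs k).le
    · refine (eLpNorm_diffQuot_le_sobolevNorm hp0 _ _).trans ((hφs _).le.trans ?_)
      refine ENNReal.ofReal_le_ofReal (one_div_le_one_div_of_le (by positivity) ?_)
      have : k ≤ ns j := hj.trans (hns.id_le j)
      gcongr
  have hlim2 : Tendsto (fun k : ℕ => C * (ENNReal.ofReal (1 / ((k : ℝ) + 1)) +
      ENNReal.ofReal (1 / ((k : ℝ) + 1)))) atTop (𝓝 0) := by
    have := ENNReal.Tendsto.const_mul (hlim.add hlim) (a := C) (Or.inr hC)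
    simpa using this
  intro ε hε
  obtain ⟨k, h1, h2⟩ := ((hlim.eventually (ge_mem_nhds hε)).and
    (hlim2.eventually (ge_mem_nhds hε))).exists
  exact ⟨φ k, hφ k, (hLp k).trans h1, (hDu k).trans h2⟩

theorem MemSobolevZero.memLp {s : ℝ} (hp : 0 < p) (hΩ : MeasurableSet Ω)
    (hu : MemSobolevZero s p Ω u) : MemLp u (ENNReal.ofReal p) volume := by
  refine ⟨hu.aestronglyMeasurable hΩ, ?_⟩
  rw [← eLpNorm_restrict_eq_of_ae_zero hΩ hu.2.1]
  have hs : s = (s + n / p) - n / p := by ring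
  have h := hu.1.2
  rw [hs] at h
  exact (eLpNorm_le_sobolevNorm hp _ _).trans_lt h

theorem MemSobolevZero.memLp_diffQuot (hn : 1 ≤ n) (hp : 1 ≤ p) (hα : 2 * (n : ℝ) < α * p)
    (hΩ : IsOpen Ω) (hne : Ωᶜ.Nonempty) (hu : MemSobolevZero (α - n / p) p Ω u) :
    MemLp (diffQuot α u) (ENNReal.ofReal p) volume := by
  have hp0 : 0 < p := by linarith
  have hum := hu.aestronglyMeasurable hΩ.measurableSet
  have hDm : ∀ v : EuclideanSpace ℝ (Fin n) → ℝ, AEStronglyMeasurable v volume →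
      AEStronglyMeasurable (diffQuot α v) volume := fun v hv =>
    aestronglyMeasurable_diffQuot volume hv
  refine ⟨hDm u hum, ?_⟩
  -- One approximant at distance 1 suffices: its quotient is finite over `Ω × Ω` by comparison with
  -- `u`, then over the whole space by the extension inequality, and `u` differs from it by a finite
  -- amount.
  obtain ⟨φ, hφ, -, h⟩ := hu.isTestLimit hn hp hα hΩ hne 1 one_pos
  obtain ⟨C, hC, hext⟩ := exists_eLpNorm_diffQuot_le hn hp hα hΩ hne
  have hφm := hDm φ hφ.continuous.aestronglyMeasurable
  have hP : 1 ≤ ENNReal.ofReal p := by simpa using hp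
  have e1 : diffQuot α u = (diffQuot α u - diffQuot α φ) + diffQuot α φ := by abel
  have e2 : diffQuot α φ = diffQuot α u - (diffQuot α u - diffQuot α φ) := by abel
  have hfin : eLpNorm (diffQuot α φ) (ENNReal.ofReal p) (volume.restrict (Ω ×ˢ Ω)) < ⊤ := by
    rw [e2]
    refine (eLpNorm_sub_le (hDm u hum).restrict ((hDm u hum).sub hφm).restrict hP).trans_lt ?_
    refine ENNReal.add_lt_top.2 ⟨(eLpNorm_diffQuot_le_sobolevNorm hp0 _ _).trans_lt hu.1.2, ?_⟩
    exact (eLpNorm_mono_measure _ Measure.restrict_le_self).trans_lt (h.trans_lt ENNReal.one_lt_top)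
  rw [e1]
  refine (eLpNorm_add_le ((hDm u hum).sub hφm) hφm hP).trans_lt (ENNReal.add_lt_top.2
    ⟨h.trans_lt ENNReal.one_lt_top, (hext φ hφ).trans_lt ?_⟩)
  exact ENNReal.mul_lt_top hC.lt_top hfin

end TestLimit

/-! ### Mollification of compactly supported functions of finite energy -/

section Mollification

/-- Jensen's inequality for the probability measure `κ`, followed by Tonelli: averaging cannot
increase a uniform `L^p` bound. -/
theorem eLpNorm_integral_le {T X : Type*} [MeasurableSpace T] [MeasurableSpace X] {κ : Measure T}
    [IsProbabilityMeasure κ] {ν : Measure X} [SFinite ν] {p : ℝ} (hp : 1 ≤ p) {F : T × X → ℝ}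
    (hF : Measurable F) {ε : ℝ≥0∞}
    (h : ∀ᵐ t ∂κ, eLpNorm (fun x => F (t, x)) (ENNReal.ofReal p) ν ≤ ε) :
    eLpNorm (fun x => ∫ t, F (t, x) ∂κ) (ENNReal.ofReal p) ν ≤ ε := by
  have hp0 : 0 < p := by linarith
  rw [← ENNReal.rpow_le_rpow_iff hp0, eLpNorm_ofReal_rpow hp0]
  have hm : Measurable fun z : T × X => ‖F z‖ₑ ^ p := by fun_prop
  calc ∫⁻ x, ‖∫ t, F (t, x) ∂κ‖ₑ ^ p ∂ν
      ≤ ∫⁻ x, ∫⁻ t, ‖F (t, x)‖ₑ ^ p ∂κ ∂ν := by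
        refine lintegral_mono fun x => ?_
        have h1 := enorm_integral_le_lintegral_enorm (μ := κ) (fun t => F (t, x))
        have h2 := eLpNorm'_le_eLpNorm'_of_exponent_le one_pos hp κ (f := fun t => F (t, x))
          (hF.comp measurable_prodMk_right).aestronglyMeasurable
        simp only [eLpNorm', ENNReal.rpow_one, div_one] at h2
        rw [one_div, ENNReal.le_rpow_inv_iff hp0] at h2
        exact (ENNReal.rpow_le_rpow h1 hp0.le).trans h2
    _ = ∫⁻ t, ∫⁻ x, ‖F (t, x)‖ₑ ^ p ∂ν ∂κ := by
        rw [lintegral_lintegral_swap]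
        exact (hm.comp measurable_swap).aemeasurable
    _ ≤ ∫⁻ _, ε ^ p ∂κ := by
        refine lintegral_mono_ae ?_
        filter_upwards [h] with t ht
        rw [← eLpNorm_ofReal_rpow hp0 (fun x => F (t, x)) ν]
        exact ENNReal.rpow_le_rpow ht hp0.le
    _ = ε ^ p := by simp

/-- Continuity of translations in `L^p`. It serves both for `w` on the space and for its difference
quotient on the product. -/
theorem exists_eLpNorm_sub_translate_le {X : Type*} [NormedAddCommGroup X] [NormedSpace ℝ X]
    [FiniteDimensional ℝ X] [MeasurableSpace X] [BorelSpace X] {ν : Measure X} [ν.IsAddHaarMeasure]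
    {P : ℝ≥0∞} (hP : 1 ≤ P) (hPt : P ≠ ⊤) {f : X → ℝ} (hf : MemLp f P ν) {ε : ℝ≥0∞} (hε : 0 < ε) :
    ∃ r > 0, ∀ h : X, ‖h‖ < r → eLpNorm (fun x => f (x - h) - f x) P ν ≤ ε := by
  have : ProperSpace X := FiniteDimensional.proper ℝ X
  have : Fact (1 ≤ P) := ⟨hP⟩
  have : Fact (P ≠ ⊤) := ⟨hPt⟩
  have hcont : Continuous fun h : X => (DomAddAct.mk (-h) +ᵥ hf.toLp f : Lp ℝ P ν) := by
    have : Continuous fun h : X => (DomAddAct.mk (-h) : Xᵈᵃᵃ) :=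
      DomAddAct.continuous_mk.comp continuous_neg
    fun_prop
  have h0 : (DomAddAct.mk (-(0 : X)) +ᵥ hf.toLp f : Lp ℝ P ν) = hf.toLp f := by
    rw [DomAddAct.mk_vadd_toLp]
    congr 1
    simp
  have := (hcont.tendsto 0).eventually (Metric.closedEBall_mem_nhds _ hε)
  obtain ⟨r, hr, hball⟩ := Metric.eventually_nhds_iff.1 this
  refine ⟨r, hr, fun h hh => ?_⟩
  have := hball (y := h) (by simpa using hh)
  rw [h0, DomAddAct.mk_vadd_toLp, Lp.edist_toLp_toLp] at this
  refine le_trans (le_of_eq ?_) this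
  congr 1
  ext x
  simp [sub_eq_neg_add]

open scoped Convolution
open ContinuousLinearMap (lsmul)

variable {n : ℕ} {α p : ℝ} {Ω : Set (EuclideanSpace ℝ (Fin n))}

/-- A function of finite energy with compact support in `Ω` is a limit of test functions. -/
theorem isTestLimit_of_compact_support (hp : 1 ≤ p) (hΩ : IsOpen Ω)
    {K : Set (EuclideanSpace ℝ (Fin n))} (hK : IsCompact K) (hKΩ : K ⊆ Ω)
    {w : EuclideanSpace ℝ (Fin n) → ℝ} (hw : Measurable w) (hwK : ∀ x ∉ K, w x = 0)
    (hwp : MemLp w (ENNReal.ofReal p) volume)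
    (hDw : MemLp (diffQuot α w) (ENNReal.ofReal p) volume) :
    IsTestLimit α p Ω w := by
  intro ε hε
  have hP : 1 ≤ ENNReal.ofReal p := by simpa using hp
  have hhaar : (volume : Measure (EuclideanSpace ℝ (Fin n) ×
      EuclideanSpace ℝ (Fin n))).IsAddHaarMeasure := by
    rw [Measure.volume_eq_prod]
    infer_instance
  obtain ⟨r₁, hr₁, h₁⟩ := exists_eLpNorm_sub_translate_le hP ENNReal.ofReal_ne_top hwp hε
  obtain ⟨r₂, hr₂, h₂⟩ := exists_eLpNorm_sub_translate_le hP ENNReal.ofReal_ne_top hDw hε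
  obtain ⟨r₃, hr₃, h₃⟩ := hK.exists_cthickening_subset_open hΩ hKΩ
  -- The three radii control, in turn, the error in `w`, the error in its difference quotient, and
  -- the support staying inside `Ω`.
  set r := min r₁ (min r₂ r₃)
  have hr : 0 < r := lt_min hr₁ (lt_min hr₂ hr₃)
  let b : ContDiffBump (0 : EuclideanSpace ℝ (Fin n)) := ⟨r / 2, r, by positivity, by linarith⟩
  set η : EuclideanSpace ℝ (Fin n) → ℝ := b.normed volume
  have hηc : Continuous η := b.continuous_normed
  have hη0 : ∀ t, 0 ≤ η t := b.nonneg_normed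
  have hηs : ∀ t, η t ≠ 0 → ‖t‖ < r := fun t ht => by
    have : t ∈ Function.support η := ht
    rw [b.support_normed_eq] at this
    simpa using this
  have hloc : LocallyIntegrable w volume := hwp.locallyIntegrable hP
  set φ := η ⋆[lsmul ℝ ℝ, volume] w
  -- Seen as integration against the probability measure with density `η`, convolution becomes an
  -- average of translates.
  set κ := (volume : Measure (EuclideanSpace ℝ (Fin n))).withDensity fun t => ENNReal.ofReal (η t)
  have hηm : Measurable fun t => ENNReal.ofReal (η t) := by
    have := hηc.measurable
    fun_prop
  have hκint : ∀ g : EuclideanSpace ℝ (Fin n) → ℝ, ∫ t, g t ∂κ = ∫ t, η t • g t := fun g => by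
    rw [integral_withDensity_eq_integral_toReal_smul hηm (by simp)]
    simp [ENNReal.toReal_ofReal, hη0]
  have hκi : ∀ g : EuclideanSpace ℝ (Fin n) → ℝ, Integrable g κ ↔
      Integrable (fun t => η t • g t) volume := fun g => by
    rw [integrable_withDensity_iff_integrable_smul' hηm (by simp)]
    simp [ENNReal.toReal_ofReal, hη0]
  have hκp : IsProbabilityMeasure κ := by
    constructor
    rw [withDensity_apply _ MeasurableSet.univ, Measure.restrict_univ,
      ← ofReal_integral_eq_lintegral_ofReal b.integrable_normed (Eventually.of_forall hη0),
      b.integral_normed, ENNReal.ofReal_one]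
  have hκr : ∀ᵐ t ∂κ, ‖t‖ < r := by
    rw [ae_withDensity_iff hηm]
    refine Eventually.of_forall fun t ht => hηs t fun h => ht (by simp [h])
  have hφ : ∀ x, φ x = ∫ t, w (x - t) ∂κ := fun x => by
    rw [hκint]
    rfl
  have hint : ∀ x, Integrable (fun t => w (x - t)) κ := fun x => by
    rw [hκi]
    exact b.hasCompactSupport_normed.convolutionExists_left (lsmul ℝ ℝ) hηc hloc x
  have hsupp : Function.support φ ⊆ cthickening r K := by
    refine (support_convolution_subset (lsmul ℝ ℝ)).trans ?_
    rintro _ ⟨t, ht, x, hx, rfl⟩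
    have hxK : x ∈ K := by
      by_contra h
      exact hx (hwK x h)
    refine mem_cthickening_of_dist_le _ x _ _ hxK ?_
    rw [dist_eq_norm, add_sub_cancel_right]
    exact (hηs t ht).le
  have hts : tsupport φ ⊆ cthickening r K := closure_minimal hsupp isClosed_cthickening
  refine ⟨φ, ⟨?_, ?_, ?_⟩, ?_, ?_⟩
  · exact b.hasCompactSupport_normed.contDiff_convolution_left _ b.contDiff_normed hloc
  · exact (hK.cthickening).of_isClosed_subset (isClosed_tsupport _) hts
  · refine hts.trans ((cthickening_mono ?_ K).trans h₃)
    exact (min_le_right _ _).trans (min_le_right _ _)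
  · rw [eLpNorm_sub_comm]
    have : φ - w = fun x => ∫ t, (w (x - t) - w x) ∂κ := by
      ext x
      rw [integral_sub (hint x) (integrable_const _), Pi.sub_apply, hφ]
      simp
    rw [this]
    refine eLpNorm_integral_le (F := fun z => w (z.2 - z.1) - w z.2) hp (by fun_prop) ?_
    filter_upwards [hκr] with t ht
    exact h₁ t (ht.trans_le (min_le_left _ _))
  · rw [eLpNorm_sub_comm]
    -- The denominator depends only on `z.2 - z.1`, so translating `w` by `t` translates its
    -- difference quotient by the diagonal vector `(t, t)`. Mollifying `w` thus averages diagonal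
    -- translates of `diffQuot α w`.
    have : diffQuot α φ - diffQuot α w =
        fun z => ∫ t, (diffQuot α w (z - (t, t)) - diffQuot α w z) ∂κ := by
      ext z
      have e : ∀ t, diffQuot α w (z - (t, t)) =
          (w (z.2 - t) - w (z.1 - t)) / ‖z.2 - z.1‖ ^ α := fun t => by
        simp [diffQuot]
      have hi : Integrable (fun t => diffQuot α w (z - (t, t))) κ := by
        simp_rw [e]
        exact ((hint _).sub (hint _)).div_const _
      rw [integral_sub hi (integrable_const _), Pi.sub_apply]
      simp_rw [e]
      rw [integral_div, integral_sub (hint _) (hint _), ← hφ, ← hφ]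
      simp [diffQuot]
    rw [this]
    have hm : Measurable (diffQuot α w) := measurable_diffQuot hw
    refine eLpNorm_integral_le (F := fun z : EuclideanSpace ℝ (Fin n) ×
      (EuclideanSpace ℝ (Fin n) × EuclideanSpace ℝ (Fin n)) =>
        diffQuot α w (z.2 - (z.1, z.1)) - diffQuot α w z.2) hp (by fun_prop) ?_
    filter_upwards [hκr] with t ht
    refine h₂ (t, t) ?_
    rw [Prod.norm_mk, max_self]
    exact ht.trans_le ((min_le_right _ _).trans (min_le_left _ _))

end Mollification

/-! ### Pointwise inequalities: Picone and Lipschitz bounds -/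

section Pointwise

variable {p : ℝ}

/-- The odd power `|t| ^ (p - 2) * t` of exponent `p - 1`. -/
noncomputable def signedPow (p t : ℝ) : ℝ := |t| ^ (p - 2) * t

theorem measurable_signedPow : Measurable (signedPow p) := by
  unfold signedPow
  fun_prop

theorem signedPow_neg (t : ℝ) : signedPow p (-t) = -signedPow p t := by
  simp [signedPow]

theorem abs_signedPow (hp : 1 < p) (t : ℝ) : |signedPow p t| = |t| ^ (p - 1) := by
  rcases eq_or_ne t 0 with rfl | h
  · simp [signedPow, Real.zero_rpow (by linarith : p - 1 ≠ 0)]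
  · rw [signedPow, abs_mul, abs_of_nonneg (Real.rpow_nonneg (abs_nonneg t) _),
      show p - 1 = (p - 2) + 1 by ring, Real.rpow_add_one (abs_pos.2 h).ne']

theorem signedPow_of_nonneg (hp : 1 < p) {t : ℝ} (ht : 0 ≤ t) : signedPow p t = t ^ (p - 1) := by
  have h := abs_signedPow hp t
  rwa [abs_of_nonneg ht, abs_of_nonneg] at h
  exact mul_nonneg (Real.rpow_nonneg (abs_nonneg t) _) ht

theorem signedPow_mul_self (hp : 1 < p) (t : ℝ) : signedPow p t * t = |t| ^ p := by
  rcases eq_or_ne t 0 with rfl | h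
  · simp [Real.zero_rpow (by linarith : p ≠ 0)]
  · rw [signedPow, mul_assoc, ← abs_mul_abs_self, ← mul_assoc,
      ← Real.rpow_add_one (abs_pos.2 h).ne', ← Real.rpow_add_one (abs_pos.2 h).ne']
    congr 1
    ring

/-- Splitting the kernel exponent as `α (p - 2) + α + α` distributes it over the factors, exhibiting
the weak form as an `L^{p'}`–`L^p` pairing. On the diagonal both sides vanish. -/
theorem kernel_mul_eq {E : Type*} [NormedAddCommGroup E] {α : ℝ} (u φ : E → ℝ) (z : E × E) :
    |u z.2 - u z.1| ^ (p - 2) * (u z.2 - u z.1) * (φ z.2 - φ z.1) / ‖z.2 - z.1‖ ^ (α * p) =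
      signedPow p (diffQuot α u z) * diffQuot α φ z := by
  rcases eq_or_ne z.2 z.1 with h | h
  · simp [diffQuot, signedPow, h]
  · have hr : 0 < ‖z.2 - z.1‖ := norm_pos_iff.2 (sub_ne_zero.2 h)
    have hrα : 0 < ‖z.2 - z.1‖ ^ α := Real.rpow_pos_of_pos hr _
    have e : ‖z.2 - z.1‖ ^ (α * p) =
        (‖z.2 - z.1‖ ^ α) ^ (p - 2) * ‖z.2 - z.1‖ ^ α * ‖z.2 - z.1‖ ^ α := by
      rw [← Real.rpow_mul hr.le, ← Real.rpow_add hr, ← Real.rpow_add hr]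
      congr 1
      ring
    have hq : 0 < (‖z.2 - z.1‖ ^ α) ^ (p - 2) := Real.rpow_pos_of_pos hrα _
    rw [e, signedPow, diffQuot, diffQuot, abs_div, abs_of_pos hrα,
      Real.div_rpow (abs_nonneg _) hrα.le]
    field_simp

theorem picone_of_lt (hp : 1 < p) {a b c d : ℝ} (hb : 0 < b) (hab : b < a) (hc : 0 ≤ c)
    (hd : 0 ≤ d) :
    (a - b) ^ (p - 1) * (c ^ p * a ^ (1 - p) - d ^ p * b ^ (1 - p)) ≤ |c - d| ^ p := by
  have ha : 0 < a := hb.trans hab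
  set t := b / a
  have ht : 0 < t := div_pos hb ha
  have ht1 : 0 < 1 - t := by
    have : t < 1 := (div_lt_one ha).2 hab
    linarith
  have hcd : c ≤ |c - d| + d := by linarith [le_abs_self (c - d)]
  -- Convexity of `x ^ p` is applied to `|c - d| + d = (1 - t) * (|c - d| / (1 - t)) + t * (d / t)`
  -- with `t = b / a`. These weights reproduce the powers of `a`, `b` and `a - b` in the claim.
  have conv := (convexOn_rpow hp.le).2 (mem_Ici.2 (show 0 ≤ |c - d| / (1 - t) by positivity))
    (mem_Ici.2 (show 0 ≤ d / t by positivity)) ht1.le ht.le (by ring)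
  simp only [smul_eq_mul] at conv
  have e0 : (1 - t) * (|c - d| / (1 - t)) + t * (d / t) = |c - d| + d := by field_simp
  have e1 : (1 - t) * (|c - d| / (1 - t)) ^ p = (1 - t) ^ (1 - p) * |c - d| ^ p := by
    rw [Real.div_rpow (abs_nonneg _) ht1.le, Real.rpow_sub ht1, Real.rpow_one]
    ring
  have e2 : t * (d / t) ^ p = t ^ (1 - p) * d ^ p := by
    rw [Real.div_rpow hd ht.le, Real.rpow_sub ht, Real.rpow_one]
    ring
  rw [e0, e1, e2] at conv
  have key : c ^ p ≤ (1 - t) ^ (1 - p) * |c - d| ^ p + t ^ (1 - p) * d ^ p :=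
    (Real.rpow_le_rpow hc hcd (by linarith)).trans conv
  have hat : a * t = b := by simp only [t]; field_simp
  have hab' : a - b = a * (1 - t) := by rw [mul_sub, hat, mul_one]
  have f1 : (a - b) ^ (p - 1) * a ^ (1 - p) = (1 - t) ^ (p - 1) := by
    rw [hab', Real.mul_rpow ha.le ht1.le, mul_right_comm, ← Real.rpow_add ha]
    simp
  have f2 : (a - b) ^ (p - 1) * b ^ (1 - p) = (1 - t) ^ (p - 1) * t ^ (1 - p) := by
    rw [← f1, ← hat, Real.mul_rpow ha.le ht.le]
    ring
  have f3 : (1 - t) ^ (p - 1) * (1 - t) ^ (1 - p) = 1 := by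
    rw [← Real.rpow_add ht1]
    simp
  calc (a - b) ^ (p - 1) * (c ^ p * a ^ (1 - p) - d ^ p * b ^ (1 - p))
      = (a - b) ^ (p - 1) * a ^ (1 - p) * c ^ p - (a - b) ^ (p - 1) * b ^ (1 - p) * d ^ p := by ring
    _ = (1 - t) ^ (p - 1) * (c ^ p - t ^ (1 - p) * d ^ p) := by rw [f1, f2]; ring
    _ ≤ (1 - t) ^ (p - 1) * ((1 - t) ^ (1 - p) * |c - d| ^ p) := by
        gcongr
        linarith
    _ = |c - d| ^ p := by rw [← mul_assoc, f3, one_mul]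

/-- The discrete Picone inequality. -/
theorem picone (hp : 1 < p) {a b c d : ℝ} (ha : 0 < a) (hb : 0 < b) (hc : 0 ≤ c) (hd : 0 ≤ d) :
    signedPow p (a - b) * (c ^ p * a ^ (1 - p) - d ^ p * b ^ (1 - p)) ≤ |c - d| ^ p := by
  rcases lt_trichotomy b a with h | rfl | h
  · rw [signedPow_of_nonneg hp (by linarith)]
    exact picone_of_lt hp hb h hc hd
  · simp only [sub_self, signedPow, mul_zero, zero_mul]
    positivity
  · have := picone_of_lt hp ha h hd hc
    rw [← signedPow_of_nonneg hp (by linarith), ← neg_sub a b, signedPow_neg, abs_sub_comm] at this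
    linarith

theorem abs_rpow_sub_rpow_le (hp : 1 ≤ p) {M a b : ℝ} (ha : 0 ≤ a) (haM : a ≤ M) (hb : 0 ≤ b)
    (hbM : b ≤ M) : |a ^ p - b ^ p| ≤ p * M ^ (p - 1) * |a - b| := by
  refine Convex.norm_image_sub_le_of_norm_hasDerivWithin_le (s := Icc 0 M)
    (f' := fun x => p * x ^ (p - 1)) (fun x _ =>
      (Real.hasDerivAt_rpow_const (Or.inr hp)).hasDerivWithinAt) (fun x hx => ?_)
    (convex_Icc 0 M) ⟨hb, hbM⟩ ⟨ha, haM⟩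
  rw [Real.norm_of_nonneg (mul_nonneg (by linarith) (Real.rpow_nonneg hx.1 _))]
  exact mul_le_mul_of_nonneg_left (Real.rpow_le_rpow hx.1 hx.2 (by linarith)) (by linarith)

theorem abs_rpow_neg_sub_rpow_neg_le (hp : 1 ≤ p) {ε a b : ℝ} (hε : 0 < ε) (ha : ε ≤ a)
    (hb : ε ≤ b) : |a ^ (1 - p) - b ^ (1 - p)| ≤ (p - 1) * ε ^ (-p) * |a - b| := by
  refine Convex.norm_image_sub_le_of_norm_hasDerivWithin_le (s := Ici ε)
    (f' := fun x => (1 - p) * x ^ (1 - p - 1)) (fun x hx =>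
      (Real.hasDerivAt_rpow_const (Or.inl (hε.trans_le hx).ne')).hasDerivWithinAt) (fun x hx => ?_)
    (convex_Ici ε) hb ha
  have hx0 : 0 < x := hε.trans_le hx
  rw [norm_mul, Real.norm_eq_abs, Real.norm_eq_abs, abs_of_nonneg (Real.rpow_nonneg hx0.le _),
    abs_of_nonpos (by linarith), neg_sub, show 1 - p - 1 = -p by ring]
  exact mul_le_mul_of_nonneg_left (Real.rpow_le_rpow_of_nonpos hε hx (by linarith)) (by linarith)

/-- The quotient `c ^ p * a ^ (1 - p)` is Lipschitz for bounded `c` and `a` bounded below. -/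
theorem exists_abs_picone_quotient_sub_le (hp : 1 ≤ p) {M ε : ℝ} (hM : 0 ≤ M) (hε : 0 < ε) :
    ∃ C : ℝ, 0 ≤ C ∧ ∀ a b c d : ℝ, ε ≤ a → ε ≤ b → 0 ≤ c → c ≤ M → 0 ≤ d → d ≤ M →
      |c ^ p * a ^ (1 - p) - d ^ p * b ^ (1 - p)| ≤ C * (|c - d| + |a - b|) := by
  have hp1 : 0 ≤ p - 1 := by linarith
  set C₁ := p * M ^ (p - 1) * ε ^ (1 - p)
  set C₂ := M ^ p * ((p - 1) * ε ^ (-p))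
  have h1 : 0 ≤ C₁ := by positivity
  have h2 : 0 ≤ C₂ := by positivity
  refine ⟨C₁ + C₂, by positivity, fun a b c d ha hb hc hcM hd hdM => ?_⟩
  have ha0 : 0 < a := hε.trans_le ha
  have e : c ^ p * a ^ (1 - p) - d ^ p * b ^ (1 - p) =
      (c ^ p - d ^ p) * a ^ (1 - p) + d ^ p * (a ^ (1 - p) - b ^ (1 - p)) := by ring
  have l1 : |(c ^ p - d ^ p) * a ^ (1 - p)| ≤ C₁ * |c - d| := by
    rw [abs_mul, abs_of_nonneg (Real.rpow_nonneg ha0.le _)]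
    calc |c ^ p - d ^ p| * a ^ (1 - p) ≤ p * M ^ (p - 1) * |c - d| * ε ^ (1 - p) := by
          refine mul_le_mul (abs_rpow_sub_rpow_le hp hc hcM hd hdM)
            (Real.rpow_le_rpow_of_nonpos hε ha (by linarith)) (by positivity) (by positivity)
      _ = C₁ * |c - d| := by simp only [C₁]; ring
  have l2 : |d ^ p * (a ^ (1 - p) - b ^ (1 - p))| ≤ C₂ * |a - b| := by
    rw [abs_mul, abs_of_nonneg (Real.rpow_nonneg hd _)]
    calc d ^ p * |a ^ (1 - p) - b ^ (1 - p)| ≤ M ^ p * ((p - 1) * ε ^ (-p) * |a - b|) := by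
          refine mul_le_mul (Real.rpow_le_rpow hd hdM (by linarith))
            (abs_rpow_neg_sub_rpow_neg_le hp hε ha hb) (abs_nonneg _) (by positivity)
      _ = C₂ * |a - b| := by simp only [C₂]; ring
  rw [e]
  refine (abs_add_le _ _).trans ((add_le_add l1 l2).trans ?_)
  nlinarith [abs_nonneg (c - d), abs_nonneg (a - b)]

end Pointwise

/-! ### The duality pairing with `|f| ^ (p - 2) * f` -/

section Duality

variable {X : Type*} [MeasurableSpace X] {ν : Measure X} {p : ℝ} {f g : X → ℝ}

theorem aestronglyMeasurable_signedPow (hf : AEStronglyMeasurable f ν) :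
    AEStronglyMeasurable (fun x => signedPow p (f x)) ν :=
  (measurable_signedPow.comp_aemeasurable hf.aemeasurable).aestronglyMeasurable

/-- The modulus is `|f| ^ (p - 1)`, and the conjugate exponent is `p / (p - 1)`. -/
theorem memLp_signedPow (hp : 1 < p) (hf : MemLp f (ENNReal.ofReal p) ν) :
    MemLp (fun x => signedPow p (f x)) (ENNReal.ofReal p.conjExponent) ν := by
  have h := hf.norm_rpow_div (ENNReal.ofReal (p - 1))
  rw [← ENNReal.ofReal_div_of_pos (by linarith), ENNReal.toReal_ofReal (by linarith)] at h
  refine (memLp_congr_norm (aestronglyMeasurable_signedPow hf.1) h.1 ?_).2 h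
  refine Eventually.of_forall fun x => ?_
  rw [Real.norm_eq_abs, abs_signedPow hp, Real.norm_eq_abs (f x),
    Real.norm_of_nonneg (Real.rpow_nonneg (abs_nonneg _) _)]

theorem integrable_signedPow_mul (hp : 1 < p) (hf : MemLp f (ENNReal.ofReal p) ν)
    (hg : MemLp g (ENNReal.ofReal p) ν) : Integrable (fun x => signedPow p (f x) * g x) ν := by
  have := (Real.HolderConjugate.conjExponent hp).symm.ennrealOfReal
  exact (memLp_signedPow hp hf).integrable_mul hg

/-- Pairing with `|f| ^ (p - 2) * f` is continuous on `L^p`. -/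
theorem exists_enorm_integral_signedPow_mul_le (hp : 1 < p) (hf : MemLp f (ENNReal.ofReal p) ν) :
    ∃ C : ℝ≥0∞, C ≠ ⊤ ∧ ∀ g : X → ℝ, AEStronglyMeasurable g ν →
      ‖∫ x, signedPow p (f x) * g x ∂ν‖ₑ ≤ C * eLpNorm g (ENNReal.ofReal p) ν := by
  have := (Real.HolderConjugate.conjExponent hp).symm.ennrealOfReal
  refine ⟨eLpNorm (fun x => signedPow p (f x)) (ENNReal.ofReal p.conjExponent) ν,
    (memLp_signedPow hp hf).2.ne, fun g hg => ?_⟩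
  have h := eLpNorm_smul_le_mul_eLpNorm (r := 1) hg
    (aestronglyMeasurable_signedPow (p := p) hf.1) (hpqr := this)
  rw [eLpNorm_one_eq_lintegral_enorm] at h
  exact (enorm_integral_le_lintegral_enorm _).trans h

theorem integrable_abs_rpow (hp : 0 < p) (hf : MemLp f (ENNReal.ofReal p) ν) :
    Integrable (fun x => |f x| ^ p) ν := by
  have := hf.integrable_norm_rpow (by simpa using hp) ENNReal.ofReal_ne_top
  simpa [ENNReal.toReal_ofReal hp.le] using this

theorem ofReal_integral_abs_rpow (hp : 0 < p) (hf : MemLp f (ENNReal.ofReal p) ν) :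
    ENNReal.ofReal (∫ x, |f x| ^ p ∂ν) = eLpNorm f (ENNReal.ofReal p) ν ^ p := by
  rw [ofReal_integral_eq_lintegral_ofReal (integrable_abs_rpow hp hf)
    (Eventually.of_forall fun x => by positivity), eLpNorm_ofReal_rpow hp]
  refine lintegral_congr fun x => ?_
  rw [Real.enorm_eq_ofReal_abs, ENNReal.ofReal_rpow_of_nonneg (abs_nonneg _) hp.le]

end Duality

/-! ### Extending the weak equation by density -/

section WeakEquation

variable {n : ℕ} {α p lam : ℝ} {Ω : Set (EuclideanSpace ℝ (Fin n))}
  {u : EuclideanSpace ℝ (Fin n) → ℝ}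

/-- The weak equation holds for every limit of test functions. -/
theorem IsEigenfunction.euler_lagrange_of_isTestLimit (hp : 1 < p)
    (hu : IsEigenfunction α p Ω lam u) (hup : MemLp u (ENNReal.ofReal p) volume)
    (hDu : MemLp (diffQuot α u) (ENNReal.ofReal p) volume) {w : EuclideanSpace ℝ (Fin n) → ℝ}
    (hw : IsTestLimit α p Ω w) (hwp : MemLp w (ENNReal.ofReal p) volume)
    (hDw : MemLp (diffQuot α w) (ENNReal.ofReal p) volume) :
    ∫ z, signedPow p (diffQuot α u z) * diffQuot α w z =
      lam * ∫ x, signedPow p (u x) * w x := by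
  obtain ⟨A, hA, hA'⟩ := exists_enorm_integral_signedPow_mul_le hp hDu
  obtain ⟨B, hB, hB'⟩ := exists_enorm_integral_signedPow_mul_le hp hup
  rw [← sub_eq_zero, ← enorm_eq_zero]
  set T := ‖(∫ z, signedPow p (diffQuot α u z) * diffQuot α w z) -
    lam * ∫ x, signedPow p (u x) * w x‖ₑ
  have hbound : ∀ ε : ℝ≥0∞, 0 < ε → ε ≠ ⊤ → T ≤ (A + ‖lam‖ₑ * B) * ε := by
    intro ε hε hεt
    obtain ⟨φ, hφ, h1, h2⟩ := hw ε hε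
    have hφm : AEStronglyMeasurable φ volume := hφ.continuous.aestronglyMeasurable
    have hDφm : AEStronglyMeasurable (diffQuot α φ) volume :=
      aestronglyMeasurable_diffQuot volume hφm
    have hs1 : MemLp (w - φ) (ENNReal.ofReal p) volume :=
      ⟨hwp.1.sub hφm, h1.trans_lt hεt.lt_top⟩
    have hs2 : MemLp (diffQuot α w - diffQuot α φ) (ENNReal.ofReal p) volume :=
      ⟨hDw.1.sub hDφm, h2.trans_lt hεt.lt_top⟩
    have hφp : MemLp φ (ENNReal.ofReal p) volume := by
      have := hwp.sub hs1
      rwa [sub_sub_cancel] at this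
    have hDφ : MemLp (diffQuot α φ) (ENNReal.ofReal p) volume := by
      have := hDw.sub hs2
      rwa [sub_sub_cancel] at this
    have el := hu.euler_lagrange φ hφ
    simp_rw [kernel_mul_eq] at el
    change _ = lam * ∫ x, signedPow p (u x) * φ x at el
    have e1 : ∫ z, signedPow p (diffQuot α u z) * (diffQuot α w - diffQuot α φ) z =
        (∫ z, signedPow p (diffQuot α u z) * diffQuot α w z) -
          ∫ z, signedPow p (diffQuot α u z) * diffQuot α φ z := by
      rw [← integral_sub (integrable_signedPow_mul hp hDu hDw) (integrable_signedPow_mul hp hDu hDφ)]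
      simp_rw [Pi.sub_apply, mul_sub]
    have e2 : ∫ x, signedPow p (u x) * (w - φ) x =
        (∫ x, signedPow p (u x) * w x) - ∫ x, signedPow p (u x) * φ x := by
      rw [← integral_sub (integrable_signedPow_mul hp hup hwp) (integrable_signedPow_mul hp hup hφp)]
      simp_rw [Pi.sub_apply, mul_sub]
    -- Subtracting the equation for `φ` leaves only errors linear in `w - φ`, which the two pairing
    -- bounds control.
    have e3 : (∫ z, signedPow p (diffQuot α u z) * diffQuot α w z) -
        lam * ∫ x, signedPow p (u x) * w x =
        (∫ z, signedPow p (diffQuot α u z) * (diffQuot α w - diffQuot α φ) z) -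
          lam * ∫ x, signedPow p (u x) * (w - φ) x := by
      rw [e1, e2, el]
      ring
    have : T ≤ ‖∫ z, signedPow p (diffQuot α u z) * (diffQuot α w - diffQuot α φ) z‖ₑ +
        ‖lam‖ₑ * ‖∫ x, signedPow p (u x) * (w - φ) x‖ₑ := by
      simp only [T]
      rw [e3, ← enorm_mul]
      exact enorm_sub_le
    calc T ≤ A * ε + ‖lam‖ₑ * (B * ε) := by
          refine this.trans (add_le_add ((hA' _ hs2.1).trans ?_) ?_)
          · gcongr
          · gcongr
            exact (hB' _ hs1.1).trans (by gcongr)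
      _ = _ := by ring
  have hC : A + ‖lam‖ₑ * B ≠ ⊤ := by finiteness
  have hlim : Tendsto (fun k : ℕ => (A + ‖lam‖ₑ * B) * ((k : ℝ≥0∞) + 1)⁻¹) atTop (𝓝 0) := by
    have h := ENNReal.tendsto_inv_nat_nhds_zero.comp (tendsto_add_atTop_nat 1)
    have := ENNReal.Tendsto.const_mul h (a := A + ‖lam‖ₑ * B) (Or.inr hC)
    simpa [Function.comp_def] using this
  refine le_antisymm (ge_of_tendsto' hlim fun k => hbound _ ?_ ?_) zero_le
  · simp
  · simp

end WeakEquation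

/-! ### Testing with `|φ| ^ p / (u + ε) ^ (p - 1)`: positivity and the lower bound -/

section PiconeTest

variable {n : ℕ} {α p lam : ℝ} {Ω : Set (EuclideanSpace ℝ (Fin n))}
  {u φ : EuclideanSpace ℝ (Fin n) → ℝ}

/-- The test function `|φ| ^ p / (u + ε) ^ (p - 1)`. -/
noncomputable def piconeTest {E : Type*} (p ε : ℝ) (u φ : E → ℝ) (x : E) : ℝ :=
  |φ x| ^ p * (u x + ε) ^ (1 - p)

theorem measurable_piconeTest {E : Type*} [MeasurableSpace E] {ε : ℝ} {u φ : E → ℝ}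
    (hu : Measurable u) (hφ : Measurable φ) : Measurable (piconeTest p ε u φ) := by
  unfold piconeTest
  fun_prop

theorem piconeTest_nonneg {E : Type*} {ε : ℝ} (hε : 0 < ε) {u φ : E → ℝ} (hu : ∀ x, 0 ≤ u x)
    (x : E) : 0 ≤ piconeTest p ε u φ x :=
  mul_nonneg (by positivity) (Real.rpow_nonneg (by linarith [hu x]) _)

theorem abs_diffQuot_rpow {E : Type*} [NormedAddCommGroup E] (φ : E → ℝ) (z : E × E) :
    |diffQuot α φ z| ^ p = |φ z.2 - φ z.1| ^ p / ‖z.2 - z.1‖ ^ (α * p) := by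
  rw [diffQuot, abs_div, Real.div_rpow (abs_nonneg _) (abs_nonneg _),
    abs_of_nonneg (Real.rpow_nonneg (norm_nonneg _) α), ← Real.rpow_mul (norm_nonneg _)]

theorem signedPow_mul_diffQuot_piconeTest_le {E : Type*} [NormedAddCommGroup E] (hp : 1 < p)
    {ε : ℝ} (hε : 0 < ε) {u φ : E → ℝ} (hu : ∀ x, 0 ≤ u x) (z : E × E) :
    signedPow p (diffQuot α u z) * diffQuot α (piconeTest p ε u φ) z ≤ |diffQuot α φ z| ^ p := by
  rw [← kernel_mul_eq, abs_diffQuot_rpow]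
  refine div_le_div_of_nonneg_right ?_ (Real.rpow_nonneg (norm_nonneg _) _)
  have h := picone hp (a := u z.2 + ε) (b := u z.1 + ε) (by linarith [hu z.2])
    (by linarith [hu z.1]) (abs_nonneg (φ z.2)) (abs_nonneg (φ z.1))
  rw [add_sub_add_right_eq_sub] at h
  exact h.trans (Real.rpow_le_rpow (abs_nonneg _) (abs_abs_sub_abs_le_abs_sub _ _) (by linarith))

/-- Since `φ` is bounded and `u + ε ≥ ε`, the test function is Lipschitz in the values of `|φ|` and
`u`. Its difference quotient is therefore dominated by those of `φ` and `u`, and its support lies in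
that of `φ`, so mollification applies. -/
theorem isTestLimit_piconeTest (hp : 1 < p) (hΩ : IsOpen Ω) (hum : Measurable u)
    (hu : ∀ x, 0 ≤ u x) (hDu : MemLp (diffQuot α u) (ENNReal.ofReal p) volume)
    (hφ : IsTestFunction Ω φ) (hDφ : MemLp (diffQuot α φ) (ENNReal.ofReal p) volume) {ε : ℝ}
    (hε : 0 < ε) :
    IsTestLimit α p Ω (piconeTest p ε u φ) ∧
      MemLp (piconeTest p ε u φ) (ENNReal.ofReal p) volume ∧
      MemLp (diffQuot α (piconeTest p ε u φ)) (ENNReal.ofReal p) volume := by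
  obtain ⟨M, hM⟩ := hφ.continuous.bounded_above_of_compact_support hφ.2.1
  simp only [Real.norm_eq_abs] at hM
  have hM0 : 0 ≤ M := (abs_nonneg _).trans (hM 0)
  obtain ⟨C, hC0, hC⟩ := exists_abs_picone_quotient_sub_le hp.le hM0 hε
  have hε' : ∀ x, ε ≤ u x + ε := fun x => by linarith [hu x]
  have hwm : Measurable (piconeTest p ε u φ) := measurable_piconeTest hum hφ.continuous.measurable
  have hw0 : ∀ x ∉ tsupport φ, piconeTest p ε u φ x = 0 := fun x hx => by
    simp [piconeTest, image_eq_zero_of_notMem_tsupport hx, Real.zero_rpow (by linarith : p ≠ 0)]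
  have hwp : MemLp (piconeTest p ε u φ) (ENNReal.ofReal p) volume := by
    refine (hφ.memLp _).of_le_mul (c := C) hwm.aestronglyMeasurable (Eventually.of_forall fun x => ?_)
    have := hC _ _ |φ x| 0 (hε' x) (hε' x) (abs_nonneg _) (hM x) le_rfl hM0
    simpa [piconeTest, Real.zero_rpow (by linarith : p ≠ 0)] using this
  have hDw : MemLp (diffQuot α (piconeTest p ε u φ)) (ENNReal.ofReal p) volume := by
    refine (hDφ.norm.add hDu.norm).of_le_mul (c := C)
      (measurable_diffQuot hwm).aestronglyMeasurable (Eventually.of_forall fun z => ?_)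
    have h := hC _ _ |φ z.2| |φ z.1| (hε' z.2) (hε' z.1) (abs_nonneg _) (hM _) (abs_nonneg _) (hM _)
    rw [add_sub_add_right_eq_sub] at h
    have hr : 0 ≤ ‖z.2 - z.1‖ ^ α := Real.rpow_nonneg (norm_nonneg _) _
    rw [Pi.add_apply, Real.norm_of_nonneg (add_nonneg (norm_nonneg _) (norm_nonneg _))]
    simp only [diffQuot, norm_div, Real.norm_eq_abs, abs_of_nonneg hr]
    rw [← add_div, mul_div_assoc']
    refine div_le_div_of_nonneg_right (h.trans ?_) hr
    exact mul_le_mul_of_nonneg_left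
      (add_le_add_left (abs_abs_sub_abs_le_abs_sub (φ z.2) (φ z.1)) _) hC0
  exact ⟨isTestLimit_of_compact_support hp.le hΩ hφ.2.1 hφ.2.2 hwm hw0 hwp hDw, hwp, hDw⟩

/-- The integral of the nonnegative difference in the Picone inequality is at most the energy
of `φ`, and `lam * ∫ u ^ (p - 1) |φ| ^ p / (u + ε) ^ (p - 1)` is as well. -/
theorem lintegral_picone_le (hp : 1 < p) (hΩ : IsOpen Ω) (hlam : 0 ≤ lam) (hum : Measurable u)
    (hu : ∀ x, 0 ≤ u x) (hDu : MemLp (diffQuot α u) (ENNReal.ofReal p) volume)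
    (hel : ∀ w, IsTestLimit α p Ω w → MemLp w (ENNReal.ofReal p) volume →
      MemLp (diffQuot α w) (ENNReal.ofReal p) volume →
      ∫ z, signedPow p (diffQuot α u z) * diffQuot α w z = lam * ∫ x, signedPow p (u x) * w x)
    (hφ : IsTestFunction Ω φ) (hDφ : MemLp (diffQuot α φ) (ENNReal.ofReal p) volume) {ε : ℝ}
    (hε : 0 < ε) :
    ∫⁻ z, ENNReal.ofReal (|diffQuot α φ z| ^ p -
        signedPow p (diffQuot α u z) * diffQuot α (piconeTest p ε u φ) z) ≤
      ENNReal.ofReal (∫ z, |diffQuot α φ z| ^ p) ∧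
    lam * ∫ x, signedPow p (u x) * piconeTest p ε u φ x ≤ ∫ z, |diffQuot α φ z| ^ p := by
  obtain ⟨h1, h2, h3⟩ := isTestLimit_piconeTest hp hΩ hum hu hDu hφ hDφ hε
  have e := hel _ h1 h2 h3
  have i1 := integrable_abs_rpow (by linarith) hDφ
  have i2 := integrable_signedPow_mul hp hDu h3
  have hpt := signedPow_mul_diffQuot_piconeTest_le (α := α) (φ := φ) hp hε hu
  refine ⟨?_, e ▸ integral_mono i2 i1 hpt⟩
  have h := ofReal_integral_eq_lintegral_ofReal (i1.sub i2)
    (Eventually.of_forall fun z => sub_nonneg.2 (hpt z))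
  simp only [Pi.sub_apply] at h
  rw [← h, integral_sub i1 i2, e]
  -- By the weak equation the subtracted integral is `lam * ∫ u ^ (p - 1) w_ε`, which is nonnegative
  -- and can be dropped. The resulting bound does not depend on `ε`.
  refine ENNReal.ofReal_le_ofReal (sub_le_self _ (mul_nonneg hlam (integral_nonneg fun x => ?_)))
  refine mul_nonneg ?_ (piconeTest_nonneg hε hu x)
  rw [signedPow_of_nonneg hp (hu x)]
  exact Real.rpow_nonneg (hu x) _

/-- At the zero of `u` the test function equals `|φ| ^ p ε ^ (1 - p)` and blows up, while at the
other point it stays bounded. The coefficient `signedPow p (diffQuot α u z)` is positive and fixed,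
so the Picone defect diverges. -/
theorem tendsto_picone_atTop {E : Type*} [NormedAddCommGroup E] (hp : 1 < p) {u φ : E → ℝ}
    {z : E × E} (h1 : u z.1 = 0) (h2 : 0 < u z.2) (hφ : φ z.1 ≠ 0) :
    Tendsto (fun k : ℕ => |diffQuot α φ z| ^ p - signedPow p (diffQuot α u z) *
      diffQuot α (piconeTest p (1 / ((k : ℝ) + 1)) u φ) z) atTop atTop := by
  have hne : z.2 ≠ z.1 := fun h => by
    rw [h, h1] at h2
    exact lt_irrefl _ h2
  have hr : 0 < ‖z.2 - z.1‖ ^ α := Real.rpow_pos_of_pos (norm_pos_iff.2 (sub_ne_zero.2 hne)) _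
  have hJ : 0 < signedPow p (diffQuot α u z) := by
    have : 0 < diffQuot α u z := by
      rw [diffQuot, h1, sub_zero]
      positivity
    rw [signedPow_of_nonneg hp this.le]
    positivity
  set c := signedPow p (diffQuot α u z)
  set R := ‖z.2 - z.1‖ ^ α
  have hA : 0 < |φ z.1| ^ p := Real.rpow_pos_of_pos (abs_pos.2 hφ) _
  have hlim : Tendsto (fun k : ℕ => c / R * (|φ z.1| ^ p * ((k : ℝ) + 1) ^ (p - 1) +
      -(|φ z.2| ^ p * u z.2 ^ (1 - p)))) atTop atTop := by
    refine Tendsto.const_mul_atTop (by positivity) (tendsto_atTop_add_const_right _ _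
      (Tendsto.const_mul_atTop hA ?_))
    exact (tendsto_rpow_atTop (by linarith)).comp
      (tendsto_atTop_add_const_right _ _ tendsto_natCast_atTop_atTop)
  refine tendsto_atTop_mono (fun k => ?_) hlim
  have hk : 0 < 1 / ((k : ℝ) + 1) := by positivity
  have e1 : piconeTest p (1 / ((k : ℝ) + 1)) u φ z.1 = |φ z.1| ^ p * ((k : ℝ) + 1) ^ (p - 1) := by
    rw [piconeTest, h1, zero_add, one_div, Real.inv_rpow (by positivity),
      ← Real.rpow_neg (by positivity), neg_sub]
  have e2 : piconeTest p (1 / ((k : ℝ) + 1)) u φ z.2 ≤ |φ z.2| ^ p * u z.2 ^ (1 - p) :=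
    mul_le_mul_of_nonneg_left (Real.rpow_le_rpow_of_nonpos h2 (by linarith) (by linarith))
      (by positivity)
  have e3 : 0 ≤ |diffQuot α φ z| ^ p := by positivity
  have e4 : c * diffQuot α (piconeTest p (1 / ((k : ℝ) + 1)) u φ) z ≤
      c / R * (|φ z.2| ^ p * u z.2 ^ (1 - p) - |φ z.1| ^ p * ((k : ℝ) + 1) ^ (p - 1)) := by
    rw [diffQuot, e1, div_mul_eq_mul_div, ← mul_div_assoc]
    gcongr
  have e5 : c / R * (|φ z.1| ^ p * ((k : ℝ) + 1) ^ (p - 1) + -(|φ z.2| ^ p * u z.2 ^ (1 - p))) =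
      -(c / R * (|φ z.2| ^ p * u z.2 ^ (1 - p) - |φ z.1| ^ p * ((k : ℝ) + 1) ^ (p - 1))) := by
    ring
  linarith

/-- The minimum principle: a nonnegative eigenfunction is positive almost everywhere on the set
where a test function does not vanish. -/
theorem ae_pos_of_test_ne_zero (hp : 1 < p) (hΩ : IsOpen Ω) (hlam : 0 ≤ lam) (hum : Measurable u)
    (hu : ∀ x, 0 ≤ u x) (hu0 : ¬ u =ᵐ[volume] 0)
    (hDu : MemLp (diffQuot α u) (ENNReal.ofReal p) volume)
    (hel : ∀ w, IsTestLimit α p Ω w → MemLp w (ENNReal.ofReal p) volume →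
      MemLp (diffQuot α w) (ENNReal.ofReal p) volume →
      ∫ z, signedPow p (diffQuot α u z) * diffQuot α w z = lam * ∫ x, signedPow p (u x) * w x)
    (hφ : IsTestFunction Ω φ) (hDφ : MemLp (diffQuot α φ) (ENNReal.ofReal p) volume) :
    ∀ᵐ x, φ x ≠ 0 → 0 < u x := by
  have hφm := hφ.continuous.measurable
  set G : ℕ → EuclideanSpace ℝ (Fin n) × EuclideanSpace ℝ (Fin n) → ℝ≥0∞ := fun k z =>
    ENNReal.ofReal (|diffQuot α φ z| ^ p - signedPow p (diffQuot α u z) *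
      diffQuot α (piconeTest p (1 / ((k : ℝ) + 1)) u φ) z)
  have hGm : ∀ k, Measurable (G k) := fun k => by
    have m1 : Measurable (diffQuot α φ) := measurable_diffQuot hφm
    have m2 : Measurable fun z => signedPow p (diffQuot α u z) :=
      measurable_signedPow.comp (measurable_diffQuot hum)
    have m3 : Measurable (diffQuot α (piconeTest p (1 / ((k : ℝ) + 1)) u φ)) :=
      measurable_diffQuot (measurable_piconeTest hum hφm)
    exact ((m1.abs.pow_const p).sub (m2.mul m3)).ennreal_ofReal
  have hfin : ∫⁻ z, liminf (fun k => G k z) atTop ≠ ⊤ := by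
    refine ((lintegral_liminf_le hGm).trans ?_).trans_lt
      (ENNReal.ofReal_lt_top (r := ∫ z, |diffQuot α φ z| ^ p)) |>.ne
    exact liminf_le_of_frequently_le' (Frequently.of_forall fun k =>
      (lintegral_picone_le hp hΩ hlam hum hu hDu hel hφ hDφ (by positivity)).1)
  have hae := ae_lt_top (Measurable.liminf hGm) hfin
  -- By Fatou the lower limit of the defects is finite almost everywhere, so the pairs where it is
  -- infinite form a null set. As that set contains a product, positivity somewhere forces
  -- positivity on `{φ ≠ 0}`: this is where nonlocality enters.
  have hnull : (volume : Measure (EuclideanSpace ℝ (Fin n) × EuclideanSpace ℝ (Fin n)))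
      ({x | u x = 0 ∧ φ x ≠ 0} ×ˢ {y | 0 < u y}) = 0 := by
    refine measure_mono_null (fun z hz => ?_) hae
    obtain ⟨⟨h1, h2⟩, h3⟩ := hz
    have := ENNReal.tendsto_ofReal_atTop.comp (tendsto_picone_atTop (α := α) hp h1 h3 h2)
    have hlim : liminf (fun k => G k z) atTop = ⊤ := this.liminf_eq
    simp [hlim]
  rw [Measure.volume_eq_prod, Measure.prod_prod, mul_eq_zero] at hnull
  rcases hnull with h | h
  · rw [ae_iff]
    refine measure_mono_null (fun x hx => ?_) h
    simp only [mem_ofPred_eq, Classical.not_imp, not_lt] at hx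
    exact ⟨le_antisymm hx.2 (hu x), hx.1⟩
  · refine absurd ?_ hu0
    rw [EventuallyEq, ae_iff]
    refine measure_mono_null (fun x hx => ?_) h
    exact lt_of_le_of_ne (hu x) (Ne.symm hx)

/-- The eigenvalue of a nonnegative eigenfunction bounds the Rayleigh quotient of test functions
from below. -/
theorem mul_integral_abs_rpow_le (hp : 1 < p) (hΩ : IsOpen Ω) (hlam : 0 ≤ lam) (hum : Measurable u)
    (hu : ∀ x, 0 ≤ u x) (hu0 : ¬ u =ᵐ[volume] 0)
    (hDu : MemLp (diffQuot α u) (ENNReal.ofReal p) volume)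
    (hel : ∀ w, IsTestLimit α p Ω w → MemLp w (ENNReal.ofReal p) volume →
      MemLp (diffQuot α w) (ENNReal.ofReal p) volume →
      ∫ z, signedPow p (diffQuot α u z) * diffQuot α w z = lam * ∫ x, signedPow p (u x) * w x)
    (hφ : IsTestFunction Ω φ) (hDφ : MemLp (diffQuot α φ) (ENNReal.ofReal p) volume) :
    lam * ∫ x, |φ x| ^ p ≤ ∫ z, |diffQuot α φ z| ^ p := by
  have hpos := ae_pos_of_test_ne_zero hp hΩ hlam hum hu hu0 hDu hel hφ hDφ
  have hφm := hφ.continuous.measurable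
  have heq : ∀ (ε : ℝ) x, signedPow p (u x) * piconeTest p ε u φ x =
      |φ x| ^ p * (u x ^ (p - 1) * (u x + ε) ^ (1 - p)) := fun ε x => by
    rw [signedPow_of_nonneg hp (hu x), piconeTest]
    ring
  have hlim : Tendsto (fun k : ℕ =>
      ∫ x, signedPow p (u x) * piconeTest p (1 / ((k : ℝ) + 1)) u φ x) atTop
      (𝓝 (∫ x, |φ x| ^ p)) := by
    refine tendsto_integral_of_dominated_convergence (fun x => |φ x| ^ p) (fun k => ?_)
      (integrable_abs_rpow (by linarith) (hφ.memLp _)) (fun k => Eventually.of_forall fun x => ?_) ?_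
    · exact ((measurable_signedPow.comp hum).mul
        (measurable_piconeTest hum hφm)).aestronglyMeasurable
    · have hk : 0 < 1 / ((k : ℝ) + 1) := by positivity
      have hx := hu x
      have hs : 0 < u x + 1 / ((k : ℝ) + 1) := by linarith
      rw [heq, Real.norm_of_nonneg (by positivity)]
      refine mul_le_of_le_one_right (by positivity) ?_
      calc u x ^ (p - 1) * (u x + 1 / ((k : ℝ) + 1)) ^ (1 - p)
          ≤ (u x + 1 / ((k : ℝ) + 1)) ^ (p - 1) * (u x + 1 / ((k : ℝ) + 1)) ^ (1 - p) := by
            gcongr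
            linarith
        _ = 1 := by
            rw [← Real.rpow_add hs]
            simp
    -- Positivity of `u` is essential here: where `u x > 0` the ratio `u ^ (p - 1) (u + ε) ^ (1 -
    -- p)` tends to `1`, whereas at a zero of `u` it would be `0` for every `ε`.
    · filter_upwards [hpos] with x hx
      simp_rw [heq]
      by_cases h0 : φ x = 0
      · simp [h0, Real.zero_rpow (by linarith : p ≠ 0)]
      · have hux := hx h0
        have h1 : Tendsto (fun k : ℕ => u x + 1 / ((k : ℝ) + 1)) atTop (𝓝 (u x + 0)) :=
          tendsto_const_nhds.add tendsto_one_div_add_atTop_nhds_zero_nat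
        rw [add_zero] at h1
        have h2 := ((h1.rpow_const (p := 1 - p) (Or.inl hux.ne')).const_mul
          (u x ^ (p - 1))).const_mul (|φ x| ^ p)
        rw [← Real.rpow_add hux] at h2
        simpa using h2
  exact le_of_tendsto' (hlim.const_mul lam) fun k =>
    (lintegral_picone_le hp hΩ hlam hum hu hDu hel hφ hDφ (by positivity)).2

end PiconeTest

/-! ### Rayleigh quotients of limits of test functions -/

section Rayleigh

variable {n : ℕ} {α p lam : ℝ} {Ω : Set (EuclideanSpace ℝ (Fin n))}
  {u v : EuclideanSpace ℝ (Fin n) → ℝ}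

theorem rayleigh_eq (hp : 0 < p) (v : EuclideanSpace ℝ (Fin n) → ℝ) :
    rayleigh α p v = eLpNorm (diffQuot α v) (ENNReal.ofReal p) volume ^ p /
      eLpNorm v (ENNReal.ofReal p) volume ^ p := by
  rw [rayleigh, lintegral_kernel_eq hp, lintegral_abs_rpow_eq hp]

theorem le_rayleigh_iff (hp : 0 < p) (hv : MemLp v (ENNReal.ofReal p) volume)
    (hv0 : ¬ v =ᵐ[volume] 0) (c : ℝ≥0∞) :
    c ≤ rayleigh α p v ↔ c * eLpNorm v (ENNReal.ofReal p) volume ^ p ≤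
      eLpNorm (diffQuot α v) (ENNReal.ofReal p) volume ^ p := by
  have h0 : eLpNorm v (ENNReal.ofReal p) volume ≠ 0 := by
    rwa [Ne, eLpNorm_eq_zero_iff hv.1 (by simpa using hp)]
  rw [rayleigh_eq hp, ENNReal.le_div_iff_mul_le]
  · left
    rw [Ne, ENNReal.rpow_eq_zero_iff_of_pos hp]
    exact h0
  · left
    exact ENNReal.rpow_ne_top_of_nonneg hp.le hv.2.ne

theorem firstEigenvalue_mul_le {φ : EuclideanSpace ℝ (Fin n) → ℝ} (hp : 0 < p)
    (hφ : IsTestFunction Ω φ) :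
    firstEigenvalue α p Ω * eLpNorm φ (ENNReal.ofReal p) volume ^ p ≤
      eLpNorm (diffQuot α φ) (ENNReal.ofReal p) volume ^ p := by
  by_cases h0 : φ = 0
  · simp [h0, hp]
  · rw [← le_rayleigh_iff hp (hφ.memLp _)]
    · exact iInf₂_le φ ⟨hφ, h0⟩
    · rwa [Continuous.ae_eq_iff_eq volume hφ.continuous continuous_zero]

/-- The first eigenvalue bounds the Rayleigh quotient of every limit of test functions. -/
theorem firstEigenvalue_le_rayleigh (hp : 1 ≤ p) (hv : MemLp v (ENNReal.ofReal p) volume)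
    (hv0 : ¬ v =ᵐ[volume] 0) (hvl : IsTestLimit α p Ω v) (htop : firstEigenvalue α p Ω ≠ ⊤) :
    firstEigenvalue α p Ω ≤ rayleigh α p v := by
  have hp0 : 0 < p := by linarith
  have hP : 1 ≤ ENNReal.ofReal p := by simpa using hp
  -- After taking a `p`-th root the bound reads `L ‖v‖ ≤ ‖Dv‖` in `L^p` norms, a form that passes to
  -- limits by the triangle inequality.
  set L := firstEigenvalue α p Ω ^ (1 / p)
  have hLt : L ≠ ⊤ := ENNReal.rpow_ne_top_of_nonneg (by positivity) htop
  have hL : L ^ p = firstEigenvalue α p Ω := by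
    rw [← ENNReal.rpow_mul, one_div, inv_mul_cancel₀ hp0.ne', ENNReal.rpow_one]
  rw [le_rayleigh_iff hp0 hv hv0, ← hL, ← ENNReal.mul_rpow_of_nonneg _ _ hp0.le,
    ENNReal.rpow_le_rpow_iff hp0]
  have hbound : ∀ ε : ℝ≥0∞, 0 < ε → L * eLpNorm v (ENNReal.ofReal p) volume ≤
      eLpNorm (diffQuot α v) (ENNReal.ofReal p) volume + (1 + L) * ε := by
    intro ε hε
    obtain ⟨φ, hφ, h1, h2⟩ := hvl ε hε
    have hφm : AEStronglyMeasurable φ volume := hφ.continuous.aestronglyMeasurable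
    have hDφm : AEStronglyMeasurable (diffQuot α φ) volume :=
      aestronglyMeasurable_diffQuot volume hφm
    have hDvm : AEStronglyMeasurable (diffQuot α v) volume :=
      aestronglyMeasurable_diffQuot volume hv.1
    have h3 : L * eLpNorm φ (ENNReal.ofReal p) volume ≤
        eLpNorm (diffQuot α φ) (ENNReal.ofReal p) volume := by
      rw [← ENNReal.rpow_le_rpow_iff hp0, ENNReal.mul_rpow_of_nonneg _ _ hp0.le, hL]
      exact firstEigenvalue_mul_le hp0 hφ
    have h4 : eLpNorm v (ENNReal.ofReal p) volume ≤
        ε + eLpNorm φ (ENNReal.ofReal p) volume := by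
      have := eLpNorm_add_le (hv.1.sub hφm) hφm hP
      rw [sub_add_cancel] at this
      exact this.trans (by gcongr)
    have h5 : eLpNorm (diffQuot α φ) (ENNReal.ofReal p) volume ≤
        eLpNorm (diffQuot α v) (ENNReal.ofReal p) volume + ε := by
      have := eLpNorm_sub_le hDvm (hDvm.sub hDφm) hP
      rw [sub_sub_cancel] at this
      exact this.trans (by gcongr)
    calc L * eLpNorm v (ENNReal.ofReal p) volume
        ≤ L * (ε + eLpNorm φ (ENNReal.ofReal p) volume) := by gcongr
      _ = L * ε + L * eLpNorm φ (ENNReal.ofReal p) volume := mul_add _ _ _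
      _ ≤ L * ε + (eLpNorm (diffQuot α v) (ENNReal.ofReal p) volume + ε) := by
          gcongr
          exact h3.trans h5
      _ = _ := by ring
  have hlim : Tendsto (fun k : ℕ => eLpNorm (diffQuot α v) (ENNReal.ofReal p) volume +
      (1 + L) * ((k : ℝ≥0∞) + 1)⁻¹) atTop
      (𝓝 (eLpNorm (diffQuot α v) (ENNReal.ofReal p) volume)) := by
    have h := ENNReal.tendsto_inv_nat_nhds_zero.comp (tendsto_add_atTop_nat 1)
    have := (ENNReal.Tendsto.const_mul h (a := 1 + L) (Or.inr (by finiteness))).const_add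
      (eLpNorm (diffQuot α v) (ENNReal.ofReal p) volume)
    simpa [Function.comp_def] using this
  exact ge_of_tendsto' hlim fun k => hbound _ (by simp)

theorem firstEigenvalue_ne_top (hp : 1 ≤ p) (hv : MemLp v (ENNReal.ofReal p) volume)
    (hDv : MemLp (diffQuot α v) (ENNReal.ofReal p) volume) (hv0 : ¬ v =ᵐ[volume] 0)
    (hvl : IsTestLimit α p Ω v) : firstEigenvalue α p Ω ≠ ⊤ := by
  have hp0 : 0 < p := by linarith
  have hP : 1 ≤ ENNReal.ofReal p := by simpa using hp
  have hN : eLpNorm v (ENNReal.ofReal p) volume ≠ 0 := by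
    rwa [Ne, eLpNorm_eq_zero_iff hv.1 (by simpa using hp0)]
  -- An error strictly below `‖v‖` forces the approximating test function to be nonzero, and it
  -- inherits finite energy from `v`; it is thus a competitor with finite quotient.
  obtain ⟨ε, hε, hεN⟩ := exists_between (pos_iff_ne_zero.2 hN)
  obtain ⟨φ, hφ, h1, h2⟩ := hvl ε hε
  have hφ0 : φ ≠ 0 := by
    rintro rfl
    rw [sub_zero] at h1
    exact absurd hεN (not_lt.2 h1)
  have hφm : AEStronglyMeasurable φ volume := hφ.continuous.aestronglyMeasurable
  have hDφm : AEStronglyMeasurable (diffQuot α φ) volume :=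
    aestronglyMeasurable_diffQuot volume hφm
  have hDφ : eLpNorm (diffQuot α φ) (ENNReal.ofReal p) volume < ⊤ := by
    have := eLpNorm_sub_le hDv.1 (hDv.1.sub hDφm) hP
    rw [sub_sub_cancel] at this
    exact this.trans_lt (ENNReal.add_lt_top.2 ⟨hDv.2, h2.trans_lt (hεN.trans_le le_top)⟩)
  have hφN : eLpNorm φ (ENNReal.ofReal p) volume ≠ 0 := by
    rwa [Ne, eLpNorm_eq_zero_iff hφm (by simpa using hp0),
      Continuous.ae_eq_iff_eq volume hφ.continuous continuous_zero]
  refine ((iInf₂_le φ ⟨hφ, hφ0⟩ : firstEigenvalue α p Ω ≤ rayleigh α p φ).trans_lt ?_).ne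
  rw [rayleigh_eq hp0]
  refine ENNReal.div_lt_top (ENNReal.rpow_ne_top_of_nonneg hp0.le hDφ.ne) ?_
  rwa [Ne, ENNReal.rpow_eq_zero_iff_of_pos hp0]

theorem compl_nonempty_of_isBounded (hn : 1 ≤ n) (hΩb : Bornology.IsBounded Ω) :
    Ωᶜ.Nonempty := by
  have : Nonempty (Fin n) := ⟨⟨0, hn⟩⟩
  rw [nonempty_compl]
  rintro rfl
  exact NormedSpace.unbounded_univ ℝ (EuclideanSpace ℝ (Fin n)) hΩb

end Rayleigh

end FractionalEigenvalue

/-! ### Conclusion: `λ = R(u) = λ₁` -/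

open FractionalEigenvalue in
theorem mainTheorem8 {n : ℕ} (hn : 1 ≤ n) {α p : ℝ} (hp : 2 ≤ p)
    (hα : 2 * (n : ℝ) < α * p) (hα' : α * p < n + p)
    {Ω : Set (EuclideanSpace ℝ (Fin n))} (hΩo : IsOpen Ω) (hΩc : IsConnected Ω)
    (hΩb : Bornology.IsBounded Ω)
    {lam : ℝ} {u : EuclideanSpace ℝ (Fin n) → ℝ}
    (hu : FractionalEigenvalue.IsEigenfunction α p Ω lam u)
    (hu0 : ∀ᵐ x, 0 ≤ u x) :
    FractionalEigenvalue.IsRayleighMinimizer α p Ω u ∧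
      FractionalEigenvalue.firstEigenvalue α p Ω ≠ ⊤ ∧
      lam = (FractionalEigenvalue.firstEigenvalue α p Ω).toReal := by
  have hp1 : 1 < p := by linarith
  have hp0 : 0 < p := by linarith
  have hne := compl_nonempty_of_isBounded hn hΩb
  have hup := hu.mem.memLp hp0 hΩo.measurableSet
  have hDu := hu.mem.memLp_diffQuot hn hp1.le hα hΩo hne
  have hul := hu.mem.isTestLimit hn hp1.le hα hΩo hne
  -- Testing with `u` itself identifies its energy with `lam * ∫ |u| ^ p`.
  have energy := hu.euler_lagrange_of_isTestLimit hp1 hup hDu hul hup hDu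
  simp_rw [signedPow_mul_self hp1] at energy
  have hE := ofReal_integral_abs_rpow hp0 hDu
  have hN := ofReal_integral_abs_rpow hp0 hup
  have hNne : eLpNorm u (ENNReal.ofReal p) volume ^ p ≠ 0 := by
    rw [Ne, ENNReal.rpow_eq_zero_iff_of_pos hp0, eLpNorm_eq_zero_iff hup.1 (by simpa using hp0)]
    exact hu.ne_zero
  have hNt : eLpNorm u (ENNReal.ofReal p) volume ^ p ≠ ⊤ :=
    ENNReal.rpow_ne_top_of_nonneg hp0.le hup.2.ne
  have hNpos : 0 < ∫ x, |u x| ^ p := by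
    rw [← hN] at hNne
    simpa using hNne
  have hlam : 0 ≤ lam := by
    have : 0 ≤ lam * ∫ x, |u x| ^ p := energy ▸ integral_nonneg fun z => by positivity
    exact nonneg_of_mul_nonneg_left this hNpos
  have hR : rayleigh α p u = ENNReal.ofReal lam := by
    rw [rayleigh_eq hp0, ← hE, energy, ENNReal.ofReal_mul hlam, hN,
      ENNReal.mul_div_cancel_right hNne hNt]
  -- The Picone argument needs `u + ε` to be measurable and positive at every point, so a
  -- representative that is nonnegative everywhere replaces `u`.
  obtain ⟨u', hu'm, hu'0, hae⟩ : ∃ u' : EuclideanSpace ℝ (Fin n) → ℝ,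
      Measurable u' ∧ (∀ x, 0 ≤ u' x) ∧ u =ᵐ[volume] u' := by
    refine ⟨fun x => max (hup.1.mk u x) 0, hup.1.stronglyMeasurable_mk.measurable.max
      measurable_const, fun x => le_max_right _ _, ?_⟩
    filter_upwards [hup.1.ae_eq_mk, hu0] with x h1 h2
    rw [← h1, max_eq_left h2]
  have hDae : diffQuot α u =ᵐ[volume] diffQuot α u' := diffQuot_congr_ae volume hae
  have hel : ∀ w, IsTestLimit α p Ω w → MemLp w (ENNReal.ofReal p) volume →
      MemLp (diffQuot α w) (ENNReal.ofReal p) volume →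
      ∫ z, signedPow p (diffQuot α u' z) * diffQuot α w z =
        lam * ∫ x, signedPow p (u' x) * w x := by
    intro w h1 h2 h3
    have := hu.euler_lagrange_of_isTestLimit hp1 hup hDu h1 h2 h3
    rw [integral_congr_ae (g := fun z => signedPow p (diffQuot α u' z) * diffQuot α w z),
      integral_congr_ae (g := fun x => signedPow p (u' x) * w x)] at this
    · exact this
    · filter_upwards [hae] with x hx
      rw [hx]
    · filter_upwards [hDae] with z hz
      rw [hz]
  have hle : ENNReal.ofReal lam ≤ firstEigenvalue α p Ω := by
    refine le_iInf₂ fun φ hφ => ?_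
    have hφ1 : IsTestFunction Ω φ := hφ.1
    rw [le_rayleigh_iff hp0 (hφ1.memLp _)
      (by rw [Continuous.ae_eq_iff_eq volume hφ1.continuous continuous_zero]; exact hφ.2)]
    -- A test function of infinite energy satisfies the bound trivially; the Picone argument is used
    -- only for finite energy.
    by_cases ht : eLpNorm (diffQuot α φ) (ENNReal.ofReal p) volume = ⊤
    · simp [ht, hp0]
    have hDφ : MemLp (diffQuot α φ) (ENNReal.ofReal p) volume :=
      ⟨aestronglyMeasurable_diffQuot volume hφ1.continuous.aestronglyMeasurable, lt_top_iff_ne_top.2 ht⟩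
    have h := mul_integral_abs_rpow_le hp1 hΩo hlam hu'm hu'0
      (fun h => hu.ne_zero (hae.trans h)) ((memLp_congr_ae hDae).1 hDu) hel hφ1 hDφ
    rw [← ofReal_integral_abs_rpow hp0 hDφ, ← ofReal_integral_abs_rpow hp0 (hφ1.memLp _),
      ← ENNReal.ofReal_mul hlam]
    exact ENNReal.ofReal_le_ofReal h
  have htop := firstEigenvalue_ne_top hp1.le hup hDu hu.ne_zero hul
  have hge := firstEigenvalue_le_rayleigh hp1.le hup hu.ne_zero hul htop
  -- Density gives `λ₁ ≤ R(u) = λ` and the Picone argument gives `λ ≤ λ₁`.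
  have heq : firstEigenvalue α p Ω = ENNReal.ofReal lam := le_antisymm (hge.trans_eq hR) hle
  refine ⟨⟨hu.mem, hu.ne_zero, hR.trans heq.symm, fun v hv hv0 => ?_⟩, htop, ?_⟩
  · rw [hR, ← heq]
    exact firstEigenvalue_le_rayleigh hp1.le (hv.memLp hp0 hΩo.measurableSet) hv0
      (hv.isTestLimit hn hp1.le hα hΩo hne) htop
  · rw [heq, ENNReal.toReal_ofReal hlam]
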